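/- An $n$-uniform hypergraph is a pair $(V,E)$ with $V$ finite and $E\subseteq\binom{V}{n}$; a proper two-coloring assigns Red or Blue to the vertices so that no hyperedge is monochromatic. In the one-pass streaming model every vertex is encoded by $B$ bits, the hyperedges arrive one at a time in an arbitrary order, each as an $n$-tuple of vertices, and the algorithm knows $n$ and $B$, but neither $V$ nor $|E|$ in advance. Let $n\ge 100$. There is a randomized one-pass streaming algorithm (a single program, on a random access machine with logarithmic costs that can toss fair coins) such that, for every $n$-uniform hypergraph $(V,E)$ with $v=|V|\ge n$ vertices, every $B$-bit encoding of the vertices and every order of arrival: (i) for all outcomes of the coin tosses, the algorithm uses $O(vB)$ bits of work space; at any moment it maintains a coloring, with the colors Red and Blue, of the vertices encountered so far; it spends time $O(nvB)$ on each hyperedge to update this coloring, and the coloring can be printed in time $O(nvB)$; (ii) for all outcomes of the coin tosses, when the stream ends the algorithm either outputs the maintained coloring, which is then a proper two-coloring of the hypergraph, or declares failure; so it never outputs an invalid coloring; (iii) if $|E|\le \frac{1}{10}\sqrt{\frac{n}{\ln n}}\,2^n$, then with probability at least $\frac34$ it outputs a proper two-coloring. The constants in $O(\cdot)$ are absolute.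 -/

import Mathlib

namespace StreamColoring

/-! ### The machine: a probabilistic random access machine with logarithmic costs -/

/-- Binary operations on natural numbers; `lt` and `eq` return `0` or `1`. -/
inductive BinOp where
  | add | sub | mul | div | lt | eq

/-- The value of an operation (`sub` is truncated, `div` rounds down). -/
def BinOp.eval : BinOp → ℕ → ℕ → ℕ
  | .add, a, b => a + b
  | .sub, a, b => a - b
  | .mul, a, b => a * b
  | .div, a, b => a / b
  | .lt, a, b => if a < b then 1 else 0
  | .eq, a, b => if a = b then 1 else 0

/-- Bit cost of an operation: linear in the lengths of the operands for `add`, `sub`, `lt`, `eq`,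
and the schoolbook bound (product of the lengths) for `mul`, `div`. -/
def BinOp.cost : BinOp → ℕ → ℕ → ℕ
  | .mul, a, b => (1 + a.size) * (1 + b.size)
  | .div, a, b => (1 + a.size) * (1 + b.size)
  | _, a, b => 1 + a.size + b.size

/-- Elementary instructions. Arguments named `x y z` are names of registers. -/
inductive Instr where
  /-- `x := k` -/
  | const (x k : ℕ)
  /-- `x := y` -/
  | copy (x y : ℕ)
  /-- `x := y ∘ z` -/
  | op (o : BinOp) (x y z : ℕ)
  /-- `x := mem[y]` -/
  | load (x y : ℕ)
  /-- `mem[x] := y` -/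
  | store (x y : ℕ)
  /-- `x :=` the next vertex of the hyperedge that is being presented (`0` if there is none) -/
  | read (x : ℕ)
  /-- `x :=` a fresh fair random bit -/
  | flip (x : ℕ)
  /-- write the pair `(x, y)` on the write-only output -/
  | print (x y : ℕ)
  /-- declare failure (irrevocably) -/
  | declareFailure

/-- Programs. The conditions test whether a register is nonzero. -/
inductive Prog where
  | instr (i : Instr)
  | seq (p q : Prog)
  | ite (x : ℕ) (p q : Prog)
  | while (x : ℕ) (p : Prog)

/-- A configuration: registers and memory (all but finitely many of them `0`), the part of the
current hyperedge that has not been read yet, the number of random bits used so far, the pairs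
printed so far, and whether failure has been declared. -/
structure State where
  reg : ℕ →₀ ℕ
  mem : ℕ →₀ ℕ
  input : List ℕ
  used : ℕ
  out : List (ℕ × ℕ)
  failed : Bool

/-- Number of bits needed to write down a finitely supported array: each nonzero cell is charged for
its address and for its content. -/
def bits (f : ℕ →₀ ℕ) : ℕ := f.sum fun a k => a.size + k.size

/-- Number of bits of work space in use. The input stream, the source of random bits and the
write-only output are not work space. -/
def State.space (s : State) : ℕ := bits s.reg + bits s.mem

/-- Assign the value `k` to register `x`. -/
noncomputable def State.set (s : State) (x k : ℕ) : State := { s with reg := s.reg.update x k }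

/-- The effect of an instruction, where `ω` is the sequence of random bits. -/
noncomputable def Instr.exec (ω : ℕ → Bool) : Instr → State → State
  | .const x k, s => s.set x k
  | .copy x y, s => s.set x (s.reg y)
  | .op o x y z, s => s.set x (o.eval (s.reg y) (s.reg z))
  | .load x y, s => s.set x (s.mem (s.reg y))
  | .store x y, s => { s with mem := s.mem.update (s.reg x) (s.reg y) }
  | .read x, s => { s.set x (s.input.headD 0) with input := s.input.tail }
  | .flip x, s => { s.set x (ω s.used).toNat with used := s.used + 1 }
  | .print x y, s => { s with out := s.out ++ [(s.reg x, s.reg y)] }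
  | .declareFailure, s => { s with failed := true }

/-- The time taken by an instruction (in bit operations). -/
def Instr.cost : Instr → State → ℕ
  | .const _ k, _ => 1 + k.size
  | .copy _ y, s => 1 + (s.reg y).size
  | .op o _ y z, s => o.cost (s.reg y) (s.reg z)
  | .load _ y, s => 1 + (s.reg y).size + (s.mem (s.reg y)).size
  | .store x y, s => 1 + (s.reg x).size + (s.reg y).size
  | .read _, s => 1 + (s.input.headD 0).size
  | .flip _, _ => 1
  | .print x y, s => 1 + (s.reg x).size + (s.reg y).size
  | .declareFailure, _ => 1

/-- `Exec ω p s s' t m`: with random bits `ω`, the program `p` started in configuration `s` halts in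
configuration `s'` after time `t`, and the largest work space of a configuration that occurs on the
way (`s` and `s'` included) is `m` bits. -/
inductive Exec (ω : ℕ → Bool) : Prog → State → State → ℕ → ℕ → Prop
  | instr (i : Instr) (s : State) :
      Exec ω (.instr i) s (i.exec ω s) (i.cost s) (max s.space (i.exec ω s).space)
  | seq {p q : Prog} {s s₁ s₂ : State} {t₁ t₂ m₁ m₂ : ℕ} :
      Exec ω p s s₁ t₁ m₁ → Exec ω q s₁ s₂ t₂ m₂ →
      Exec ω (.seq p q) s s₂ (t₁ + t₂) (max m₁ m₂)
  | iteTrue {x : ℕ} {p q : Prog} {s s' : State} {t m : ℕ} :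
      s.reg x ≠ 0 → Exec ω p s s' t m →
      Exec ω (.ite x p q) s s' (1 + (s.reg x).size + t) m
  | iteFalse {x : ℕ} {p q : Prog} {s s' : State} {t m : ℕ} :
      s.reg x = 0 → Exec ω q s s' t m →
      Exec ω (.ite x p q) s s' (1 + (s.reg x).size + t) m
  | whileFalse {x : ℕ} {p : Prog} {s : State} :
      s.reg x = 0 → Exec ω (.while x p) s s (1 + (s.reg x).size) s.space
  | whileTrue {x : ℕ} {p : Prog} {s s₁ s₂ : State} {t₁ t₂ m₁ m₂ : ℕ} :
      s.reg x ≠ 0 → Exec ω p s s₁ t₁ m₁ → Exec ω (.while x p) s₁ s₂ t₂ m₂ →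
      Exec ω (.while x p) s s₂ (1 + (s.reg x).size + t₁ + t₂) (max m₁ m₂)

/-- An execution is determined by the program, the random bits and the initial configuration. -/
theorem Exec.unique {ω : ℕ → Bool} {p : Prog} {s s₁ s₂ : State} {t₁ t₂ m₁ m₂ : ℕ}
    (h₁ : Exec ω p s s₁ t₁ m₁) (h₂ : Exec ω p s s₂ t₂ m₂) : s₁ = s₂ ∧ t₁ = t₂ ∧ m₁ = m₂ := by
  induction h₁ generalizing s₂ t₂ m₂ with
  | instr i s => cases h₂; exact ⟨rfl, rfl, rfl⟩
  | seq _ _ ih₁ ih₂ =>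
    cases h₂ with
    | seq a b =>
      obtain ⟨rfl, rfl, rfl⟩ := ih₁ a
      obtain ⟨rfl, rfl, rfl⟩ := ih₂ b
      exact ⟨rfl, rfl, rfl⟩
  | iteTrue hx _ ih =>
    cases h₂ with
    | iteTrue _ a => obtain ⟨rfl, rfl, rfl⟩ := ih a; exact ⟨rfl, rfl, rfl⟩
    | iteFalse hx' _ => exact absurd hx' hx
  | iteFalse hx _ ih =>
    cases h₂ with
    | iteTrue hx' _ => exact absurd hx hx'
    | iteFalse _ a => obtain ⟨rfl, rfl, rfl⟩ := ih a; exact ⟨rfl, rfl, rfl⟩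
  | whileFalse hx =>
    cases h₂ with
    | whileFalse _ => exact ⟨rfl, rfl, rfl⟩
    | whileTrue hx' _ _ => exact absurd hx hx'
  | whileTrue hx _ _ ih₁ ih₂ =>
    cases h₂ with
    | whileFalse hx' => exact absurd hx' hx
    | whileTrue _ a b =>
      obtain ⟨rfl, rfl, rfl⟩ := ih₁ a
      obtain ⟨rfl, rfl, rfl⟩ := ih₂ b
      exact ⟨rfl, rfl, rfl⟩

/-! ### One-pass streaming algorithms -/

/-- A one-pass streaming algorithm: `update` is executed once for every hyperedge of the stream, in
the order of arrival; `report` prints the coloring that is currently maintained, as a list of pairs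
(vertex, color). -/
structure StreamAlg where
  update : Prog
  report : Prog

/-- The initial configuration: register `0` holds the uniformity `n`, register `1` holds the number
`B` of bits per vertex, everything else is `0`. Neither the number of vertices nor the number of
hyperedges is made known to the algorithm. -/
noncomputable def initState (n B : ℕ) : State where
  reg := (Finsupp.single 0 n).update 1 B
  mem := 0
  input := []
  used := 0
  out := []
  failed := false

/-- `A.Pass ω s S s' t m`: started in `s`, the algorithm makes one pass over the stream `S` and ends
in `s'`; the longest time spent on one hyperedge is `t`, and the largest work space is `m` bits. -/
inductive StreamAlg.Pass (A : StreamAlg) (ω : ℕ → Bool) :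
    State → List (List ℕ) → State → ℕ → ℕ → Prop
  | nil (s : State) : Pass A ω s [] s 0 s.space
  | cons {s s₁ s₂ : State} {h : List ℕ} {S : List (List ℕ)} {t₁ t₂ m₁ m₂ : ℕ} :
      Exec ω A.update { s with input := h } s₁ t₁ m₁ → Pass A ω s₁ S s₂ t₂ m₂ →
      Pass A ω s (h :: S) s₂ (max t₁ t₂) (max m₁ m₂)

/-- What is observed of a run: whether failure has been declared when the stream ends, the coloring
maintained at that moment, the longest time spent on one hyperedge, the time that reporting the
coloring takes, and the largest work space (in bits). -/
structure Result where
  failed : Bool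
  coloring : List (ℕ × ℕ)
  updateTime : ℕ
  reportTime : ℕ
  space : ℕ

/-- The output after the stream has passed: the maintained coloring, or nothing if failure has been
declared. -/
def Result.output (r : Result) : Option (List (ℕ × ℕ)) :=
  if r.failed then none else some r.coloring

/-- `A.Run n B ω S r`: on the stream `S` with random bits `ω`, the algorithm `A` (which is given `n`
and `B`) halts after each hyperedge and after the final report, with the result `r`. -/
def StreamAlg.Run (A : StreamAlg) (n B : ℕ) (ω : ℕ → Bool) (S : List (List ℕ)) (r : Result) :
    Prop :=
  ∃ (s s' : State) (m₁ m₂ : ℕ),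
    A.Pass ω (initState n B) S s r.updateTime m₁ ∧
    Exec ω A.report { s with input := [], out := [] } s' r.reportTime m₂ ∧
    r.failed = s.failed ∧ r.coloring = s'.out ∧ r.space = max m₁ m₂

theorem StreamAlg.Pass.unique {A : StreamAlg} {ω : ℕ → Bool} {s s₁ s₂ : State}
    {S : List (List ℕ)} {t₁ t₂ m₁ m₂ : ℕ}
    (h₁ : A.Pass ω s S s₁ t₁ m₁) (h₂ : A.Pass ω s S s₂ t₂ m₂) :
    s₁ = s₂ ∧ t₁ = t₂ ∧ m₁ = m₂ := by
  induction h₁ generalizing s₂ t₂ m₂ with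
  | nil s => cases h₂; exact ⟨rfl, rfl, rfl⟩
  | cons a _ ih =>
    cases h₂ with
    | cons a' b' =>
      obtain ⟨rfl, rfl, rfl⟩ := a.unique a'
      obtain ⟨rfl, rfl, rfl⟩ := ih b'
      exact ⟨rfl, rfl, rfl⟩

/-- The result of a run is determined by the stream and the random bits. -/
theorem StreamAlg.Run.unique {A : StreamAlg} {n B : ℕ} {ω : ℕ → Bool} {S : List (List ℕ)}
    {r₁ r₂ : Result} (h₁ : A.Run n B ω S r₁) (h₂ : A.Run n B ω S r₂) : r₁ = r₂ := by
  obtain ⟨f₁, c₁, u₁, p₁, k₁⟩ := r₁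
  obtain ⟨f₂, c₂, u₂, p₂, k₂⟩ := r₂
  obtain ⟨s, s', a, b, hp, he, hf, hc, hk⟩ := h₁
  obtain ⟨q, q', a', b', hp', he', hf', hc', hk'⟩ := h₂
  dsimp only at *
  obtain ⟨rfl, rfl, rfl⟩ := hp.unique hp'
  obtain ⟨rfl, rfl, rfl⟩ := he.unique he'
  subst hf hc hk hf' hc' hk'
  rfl

/-- The distribution of an infinite sequence of independent fair random bits. -/
noncomputable def fairBits : MeasureTheory.Measure (ℕ → Bool) :=
  MeasureTheory.Measure.infinitePi fun _ => (PMF.uniformOfFintype Bool).toMeasure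

/-! ### Hypergraphs, streams and colorings -/

/-- `(V, E)` is an `n`-uniform hypergraph. -/
def IsUniformHypergraph (n : ℕ) (V : Finset ℕ) (E : Finset (Finset ℕ)) : Prop :=
  ∀ e ∈ E, e ⊆ V ∧ e.card = n

/-- The stream `S` presents the hyperedges in `E` one after the other, each of them once, as a tuple
of distinct vertices (both the order of the hyperedges and the order within them are arbitrary). -/
def IsStreamOf (S : List (List ℕ)) (E : Finset (Finset ℕ)) : Prop :=
  (∀ h ∈ S, h.Nodup) ∧ (S.map List.toFinset).Nodup ∧ (S.map List.toFinset).toFinset = E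

/-- The list `L` of pairs is a coloring of the vertices in `W` with the colors `0` (red) and `1`
(blue): it contains exactly one pair for each vertex in `W`, and no others. -/
def IsTwoColoring (L : List (ℕ × ℕ)) (W : Finset ℕ) : Prop :=
  (L.map Prod.fst).Nodup ∧ (L.map Prod.fst).toFinset = W ∧ ∀ c ∈ L, c.2 = 0 ∨ c.2 = 1

/-- No hyperedge in `E` is monochromatic: each has a red vertex and a blue vertex. -/
def IsProper (L : List (ℕ × ℕ)) (E : Finset (Finset ℕ)) : Prop :=
  ∀ e ∈ E, (∃ u ∈ e, (u, 0) ∈ L) ∧ (∃ w ∈ e, (w, 1) ∈ L)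

end StreamColoring

/-! Each vertex, when first met, draws a random color and a random weight from N = 2^⌈log₂ n⌉
values; weights, with ties broken by name, order the vertices. In every hyperedge the last vertex of
each color is frozen, and the first vertex of a monochromatic hyperedge is flipped. The run fails
exactly if some vertex is both frozen and flipped. Otherwise every hyperedge gets two colors: frozen
last vertices of both colors keep them apart, and in a monochromatic hyperedge the first vertex is
flipped while the last is not (`exists_finalColor`). Two marks per vertex thus replace any memory of
past hyperedges, whence one pass and O(vB) bits.

Failure requires a vertex u that is first in a monochromatic e and last of its color in some f. Then
e ∩ f = {u}, so away from u the conditions concern distinct vertices and are independent. If u has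
relative weight x, a pair (e, f) contributes about ((1 - x)/2)^(n-1) ((1 + x)/2)^(n-1) / N, that is,
O(4^(-n)/N) for every x (`ncard_conflict_le`). Summed over all weights this is too much for K = |E|
of order √(n / ln n) 2^n. Only weights below a threshold T are therefore treated this way; if u
weighs at least T, all of e does, and a union bound over e alone suffices (`ncard_heavy_le`). With T
about N ln n / (2n) the two parts add up to at most 1/4 (`exists_threshold`,
`ncard_badAssignments_le`).

The program is tied to this description by a Hoare-style calculus (`WP`) in which each elementary
step costs at most 2B + 9. The invariant `Core` describes memory through fixed weight and color
functions, determined by the random bits and the order of discovery. `fairBits_assignment_le` turns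
the count of bad assignments into a probability. -/

namespace StreamColoring

/-! ### A weakest-precondition calculus with time and space bounds -/

/-- Configurations in which registers and memory cells hold at most `B + 4` bits, at most `32`
registers are in use, and memory is in use only in the blocks of eight cells that belong to the
vertices in `V`. -/
def Good (V : Finset ℕ) (B : ℕ) (s : State) : Prop :=
  (∀ x, s.reg x < 2 ^ (B + 4)) ∧ (∀ x, 32 ≤ x → s.reg x = 0) ∧ (∀ a, s.mem a < 2 ^ (B + 4)) ∧
    ∀ a, s.mem a ≠ 0 → a / 8 ∈ V

/-- A bound on the work space of good configurations. -/
def spaceBound (V : Finset ℕ) (B : ℕ) : ℕ := 32 * (B + 9) + 8 * V.card * (2 * B + 7)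

theorem bits_le (f : ℕ →₀ ℕ) (A : Finset ℕ) (p q : ℕ) (hA : ∀ a, f a ≠ 0 → a ∈ A)
    (hp : ∀ a ∈ A, a.size ≤ p) (hq : ∀ a, (f a).size ≤ q) : bits f ≤ A.card * (p + q) := by
  unfold bits Finsupp.sum
  calc ∑ a ∈ f.support, (a.size + (f a).size) ≤ ∑ a ∈ f.support, (p + q) :=
        Finset.sum_le_sum fun a ha =>
          add_le_add (hp a (hA a (Finsupp.mem_support_iff.1 ha))) (hq a)
    _ = f.support.card * (p + q) := by simp
    _ ≤ A.card * (p + q) := Nat.mul_le_mul_right _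
          (Finset.card_le_card fun a ha => hA a (Finsupp.mem_support_iff.1 ha))

theorem Good.space_le {V : Finset ℕ} {B : ℕ} {s : State} (hV : ∀ u ∈ V, u < 2 ^ B)
    (h : Good V B s) : s.space ≤ spaceBound V B := by
  obtain ⟨h1, h2, h3, h4⟩ := h
  refine add_le_add ?_ ?_
  · have := bits_le s.reg (Finset.range 32) 5 (B + 4)
      (fun a ha => Finset.mem_range.2 (by by_contra hc; exact ha (h2 a (by omega))))
      (fun a ha => Nat.size_le.2 (by have := Finset.mem_range.1 ha; omega))
      (fun a => Nat.size_le.2 (h1 a))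
    rw [Finset.card_range] at this
    omega
  · have := bits_le s.mem (V.biUnion fun u => (Finset.range 8).image fun i => 8 * u + i)
      (B + 3) (B + 4)
      (fun a ha => by
        refine Finset.mem_biUnion.2 ⟨a / 8, h4 a ha, Finset.mem_image.2 ⟨a % 8, ?_, ?_⟩⟩
        · exact Finset.mem_range.2 (Nat.mod_lt _ (by norm_num))
        · omega)
      (fun a ha => by
        obtain ⟨u, hu, ha⟩ := Finset.mem_biUnion.1 ha
        obtain ⟨i, hi, rfl⟩ := Finset.mem_image.1 ha
        have := Finset.mem_range.1 hi
        have := hV u hu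
        exact Nat.size_le.2 (by rw [pow_add]; omega))
      (fun a => Nat.size_le.2 (h3 a))
    refine this.trans ?_
    have hc : (V.biUnion fun u => (Finset.range 8).image fun i => 8 * u + i).card ≤ V.card * 8 :=
      Finset.card_biUnion_le_card_mul _ _ _ fun u _ => by
        simpa using Finset.card_image_le (s := Finset.range 8) (f := fun i => 8 * u + i)
    calc _ ≤ (V.card * 8) * (B + 3 + (B + 4)) := Nat.mul_le_mul_right _ hc
      _ = _ := by ring

/-- `p`, started in `s`, halts in a good configuration with the property `Q`; its time is that of at
most `k` elementary steps and its work space is bounded. -/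
def WP (V : Finset ℕ) (B : ℕ) (ω : ℕ → Bool) (p : Prog) (k : ℕ) (Q : State → Prop) (s : State) :
    Prop :=
  ∃ s' t m, Exec ω p s s' t m ∧ t ≤ k * (2 * B + 9) ∧ m ≤ spaceBound V B ∧ Good V B s' ∧ Q s'

section Rules

variable {V : Finset ℕ} {B : ℕ} {ω : ℕ → Bool} {p q : Prog} {k k₁ k₂ : ℕ} {Q Q' : State → Prop}
  {s : State} {x : ℕ}

theorem WP.mono (h : WP V B ω p k₁ Q s) (hk : k₁ ≤ k) (hQ : ∀ s', Good V B s' → Q s' → Q' s') :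
    WP V B ω p k Q' s := by
  obtain ⟨s', t, m, h1, h2, h3, h4, h5⟩ := h
  exact ⟨s', t, m, h1, h2.trans (Nat.mul_le_mul_right _ hk), h3, h4, hQ s' h4 h5⟩

theorem WP.seq (h : WP V B ω p k₁ (fun s' => Good V B s' → WP V B ω q k₂ Q s') s) :
    WP V B ω (.seq p q) (k₁ + k₂) Q s := by
  obtain ⟨s₁, t, m, h1, h2, h3, h4, h5⟩ := h
  obtain ⟨s₂, t', m', h1', h2', h3', h4', h5'⟩ := h5 h4
  exact ⟨s₂, t + t', max m m', .seq h1 h1', by rw [add_mul]; exact add_le_add h2 h2',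
    max_le h3 h3', h4', h5'⟩

theorem Good.size_reg (hs : Good V B s) (x : ℕ) : (s.reg x).size ≤ B + 4 := Nat.size_le.2 (hs.1 x)

theorem Good.size_mem (hs : Good V B s) (x : ℕ) : (s.mem x).size ≤ B + 4 :=
  Nat.size_le.2 (hs.2.2.1 x)

theorem WP.ite (hs : Good V B s) (h₁ : s.reg x ≠ 0 → WP V B ω p k Q s)
    (h₂ : s.reg x = 0 → WP V B ω q k Q s) : WP V B ω (.ite x p q) (k + 1) Q s := by
  have hx := hs.size_reg x
  by_cases h : s.reg x = 0
  · obtain ⟨s', t, m, h1, h2, h3, h4, h5⟩ := h₂ h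
    exact ⟨s', _, m, .iteFalse h h1, by rw [add_mul]; omega, h3, h4, h5⟩
  · obtain ⟨s', t, m, h1, h2, h3, h4, h5⟩ := h₁ h
    exact ⟨s', _, m, .iteTrue h h1, by rw [add_mul]; omega, h3, h4, h5⟩

/-- The index of `I` is the number of iterations still to come, so a single induction yields
termination, the time bound and the postcondition `I 0`. -/
theorem WP.while (hV : ∀ u ∈ V, u < 2 ^ B) {I : ℕ → State → Prop}
    (step : ∀ j s, Good V B s → I (j + 1) s → s.reg x ≠ 0 ∧ WP V B ω p k (I j) s)
    (done : ∀ s, Good V B s → I 0 s → s.reg x = 0) (N : ℕ) (hs : Good V B s) (hI : I N s) :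
    WP V B ω (.while x p) (N * (k + 1) + 1) (I 0) s := by
  induction N generalizing s with
  | zero =>
    have hx := hs.size_reg x
    exact ⟨s, _, _, .whileFalse (done s hs hI), by omega, hs.space_le hV, hs, hI⟩
  | succ j ih =>
    have hx := hs.size_reg x
    obtain ⟨h0, s₁, t, m, h1, h2, h3, h4, h5⟩ := step j s hs hI
    obtain ⟨s₂, t', m', h1', h2', h3', h4', h5'⟩ := ih h4 h5
    refine ⟨s₂, _, _, .whileTrue h0 h1 h1', ?_, max_le h3 h3', h4', h5'⟩
    calc 1 + (s.reg x).size + t + t'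
        ≤ (2 * B + 9) + k * (2 * B + 9) + (j * (k + 1) + 1) * (2 * B + 9) := by omega
      _ = _ := by ring

/-- The conditions under which an instruction is cheap and leads from good configurations to good
configurations. -/
def Instr.Ok (V : Finset ℕ) (B : ℕ) : Instr → State → Prop
  | .const x k, _ => x < 32 ∧ k < 2 ^ (B + 4)
  | .copy x _, _ => x < 32
  | .op .add x y z, s => x < 32 ∧ s.reg y + s.reg z < 2 ^ (B + 4)
  -- Schoolbook products and quotients could cost order B² and would break the linear budget per
  -- step; the program multiplies by doubling.
  | .op .mul _ _ _, _ => False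
  | .op .div _ _ _, _ => False
  | .op _ x _ _, _ => x < 32
  | .load x _, _ => x < 32
  | .store x _, s => s.reg x / 8 ∈ V
  | .read x, s => x < 32 ∧ s.input.headD 0 < 2 ^ (B + 4)
  | .flip x, _ => x < 32
  | .print _ _, _ => True
  | .declareFailure, _ => True

theorem Good.set (hs : Good V B s) {x k : ℕ} (hx : x < 32) (hk : k < 2 ^ (B + 4)) :
    Good V B (s.set x k) := by
  obtain ⟨h1, h2, h3, h4⟩ := hs
  refine ⟨fun y => ?_, fun y hy => ?_, h3, h4⟩ <;>
    simp only [State.set, Finsupp.coe_update, Function.update_apply]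
  · split_ifs
    exacts [hk, h1 y]
  · rw [if_neg (by omega), h2 y hy]

theorem Good.congr {s' : State} (hs : Good V B s) (h₁ : s'.reg = s.reg) (h₂ : s'.mem = s.mem) :
    Good V B s' := by
  unfold Good at *
  rwa [h₁, h₂]

theorem Good.exec {i : Instr} (hs : Good V B s) (hi : i.Ok V B s) : Good V B (i.exec ω s) := by
  have one : 1 < 2 ^ (B + 4) := Nat.one_lt_two_pow (by omega)
  cases i with
  | const x k => exact hs.set hi.1 hi.2
  | copy x y => exact hs.set hi (hs.1 y)
  | op o x y z =>
    cases o with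
    | add => exact hs.set hi.1 hi.2
    | sub => exact hs.set hi ((Nat.sub_le _ _).trans_lt (hs.1 y))
    | mul => exact hi.elim
    | div => exact hi.elim
    | lt => refine hs.set hi ?_; simp only [BinOp.eval]; split_ifs <;> omega
    | eq => refine hs.set hi ?_; simp only [BinOp.eval]; split_ifs <;> omega
  | load x y => exact hs.set hi (hs.2.2.1 _)
  | store x y =>
    obtain ⟨h1, h2, h3, h4⟩ := hs
    refine ⟨h1, h2, fun a => ?_, fun a => ?_⟩ <;>
      simp only [Instr.exec, Finsupp.coe_update, Function.update_apply]
    · split_ifs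
      exacts [h1 y, h3 a]
    · split_ifs with h
      · intro _; subst h; exact hi
      · exact h4 a
  | read x => exact (hs.set hi.1 hi.2).congr rfl rfl
  | flip x =>
    refine (hs.set (x := x) (k := (ω s.used).toNat) hi ?_).congr rfl rfl
    exact (Bool.toNat_le _).trans_lt one
  | print x y => exact hs.congr rfl rfl
  | declareFailure => exact hs.congr rfl rfl

/-- The unit 2B + 9 is the worst case over admissible instructions: 1 plus two words of B + 4 bits.
-/
theorem WP.instr (hV : ∀ u ∈ V, u < 2 ^ B) {i : Instr} (hs : Good V B s) (hi : i.Ok V B s)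
    (hQ : Q (i.exec ω s)) : WP V B ω (.instr i) 1 Q s := by
  have hg := hs.exec (ω := ω) hi
  refine ⟨_, _, _, .instr i s, ?_, max_le (hs.space_le hV) (hg.space_le hV), hg, hQ⟩
  cases i with
  | const x k => have := Nat.size_le.2 hi.2; simp only [Instr.cost]; omega
  | copy x y => have := hs.size_reg y; simp only [Instr.cost]; omega
  | op o x y z =>
    have := hs.size_reg y
    have := hs.size_reg z
    cases o with
    | mul => exact hi.elim
    | div => exact hi.elim
    | _ => simp only [Instr.cost, BinOp.cost]; omega
  | load x y =>
    have := hs.size_reg y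
    have := hs.size_mem (s.reg y)
    simp only [Instr.cost]; omega
  | store x y =>
    have := hs.size_reg x
    have := hs.size_reg y
    simp only [Instr.cost]; omega
  | read x => have := Nat.size_le.2 hi.2; simp only [Instr.cost]; omega
  | flip x => simp only [Instr.cost]; omega
  | print x y =>
    have := hs.size_reg x
    have := hs.size_reg y
    simp only [Instr.cost]; omega
  | declareFailure => simp only [Instr.cost]; omega

/-- Straight-line programs. -/
def block : List Instr → Prog
  -- Copying a register to itself serves as the empty program.
  | [] => .instr (.copy 0 0)
  | i :: l => .seq (.instr i) (block l)

/-- The effect of a straight-line program. -/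
noncomputable def execBlock (ω : ℕ → Bool) : List Instr → State → State
  | [], s => s
  | i :: l, s => execBlock ω l (i.exec ω s)

/-- All instructions of a straight-line program satisfy `Instr.Ok` when they are executed. -/
def BlockOk (V : Finset ℕ) (B : ℕ) (ω : ℕ → Bool) : List Instr → State → Prop
  | [], _ => True
  | i :: l, s => i.Ok V B s ∧ BlockOk V B ω l (i.exec ω s)

theorem WP.block (hV : ∀ u ∈ V, u < 2 ^ B) {l : List Instr} (hs : Good V B s)
    (hl : BlockOk V B ω l s) (hQ : Q (execBlock ω l s)) :
    WP V B ω (block l) (l.length + 1) Q s := by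
  induction l generalizing s with
  | nil =>
    have : Instr.exec ω (.copy 0 0) s = s := by
      simp [Instr.exec, State.set]
    refine WP.instr hV hs (by norm_num [Instr.Ok]) ?_
    rw [this]
    exact hQ
  | cons i l ih =>
    have := WP.seq (WP.instr hV (Q := fun s' => Good V B s' →
      WP V B ω (StreamColoring.block l) (l.length + 1) Q s') hs hl.1 fun hg => ih hg hl.2 hQ)
    rwa [show (i :: l).length + 1 = 1 + (l.length + 1) by simp; omega]

end Rules

@[simp] theorem State.set_reg (s : State) (x k y : ℕ) :
    (s.set x k).reg y = if y = x then k else s.reg y := by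
  simp only [State.set, Finsupp.coe_update, Function.update_apply]

@[simp] theorem State.set_mem (s : State) (x k : ℕ) : (s.set x k).mem = s.mem := rfl
@[simp] theorem State.set_used (s : State) (x k : ℕ) : (s.set x k).used = s.used := rfl
@[simp] theorem State.set_input (s : State) (x k : ℕ) : (s.set x k).input = s.input := rfl
@[simp] theorem State.set_out (s : State) (x k : ℕ) : (s.set x k).out = s.out := rfl
@[simp] theorem State.set_failed (s : State) (x k : ℕ) : (s.set x k).failed = s.failed := rfl

/-! ### The algorithm -/

/-- Let register `5` be the address of the block of the next vertex (register `4`) and register `7`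
its weight. -/
def fetchVertex : Prog :=
  -- Three doublings give the address 8u. Cells 8u, ..., 8u + 4 hold the weight (0 before
  -- discovery), the color, the frozen mark, the flip mark and the link.
  block [.read 4, .op .add 5 4 4, .op .add 5 5 5, .op .add 5 5 5, .load 7 5]

/-- Draw a random weight into register `7`. -/
def drawWeight : Prog :=
  -- Register 15 runs through the powers of two until it reaches n, so `Nat.clog 2 n` bits are drawn
  -- without computing the logarithm. The leading 1 in register 7 keeps weights positive.
  .seq (block [.const 7 1, .const 15 1, .op .lt 16 15 0])
    (.while 16 (block [.op .add 15 15 15, .flip 17, .op .add 7 7 7, .op .add 7 7 17,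
      .op .lt 16 15 0]))

/-- Store the weight, a random color and the link of a new vertex. -/
def storeVertex : Prog :=
  -- Links and register 2 hold u + 1 rather than u, so that 0 ends the list even though 0 may be a
  -- vertex.
  block [.store 5 7, .flip 8, .op .add 15 5 6, .store 15 8, .op .add 15 15 6, .op .add 15 15 6,
    .op .add 15 15 6, .store 15 2, .op .add 2 4 6]

/-- Let register `8` be the color of the vertex in register `4`, and increment register `4`. -/
def fetchColor : Prog := block [.op .add 5 5 6, .load 8 5, .op .add 4 4 6]

/-- Replace `(K, L)` by the contents of registers `(7, 4)` if that is larger. -/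
def updateMax (L K : ℕ) : Prog :=
  -- Register 15 becomes 2[K < w] + [K = w] + [L < u + 1] - 1, truncated at 0. It is nonzero exactly
  -- if (w, u + 1) is lexicographically larger than (K, L).
  .seq (block [.op .lt 15 K 7, .op .eq 16 K 7, .op .lt 17 L 4, .op .add 15 15 15,
      .op .add 15 15 16, .op .add 15 15 17, .op .sub 15 15 6])
    (.ite 15 (block [.copy L 4, .copy K 7]) (block []))

/-- Replace the contents of registers `(14, 13)` by those of registers `(7, 4)` if that is
smaller. -/
def updateMin : Prog :=
  .seq (block [.op .lt 15 7 14, .op .eq 16 7 14, .op .lt 17 4 13, .op .add 15 15 15,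
      .op .add 15 15 16, .op .add 15 15 17, .op .sub 15 15 6])
    (.ite 15 (block [.copy 13 4, .copy 14 7]) (block []))

/-- Process one vertex of a hyperedge. -/
def processVertex : Prog :=
  .seq fetchVertex <| .seq (.ite 7 (block []) (.seq drawWeight storeVertex)) <|
  .seq fetchColor <| .seq (.ite 8 (updateMax 11 12) (updateMax 9 10)) <|
  .seq updateMin (block [.op .sub 3 3 6])

/-- Set the mark `a` of the vertex whose successor is in register `L`, and declare failure if the
mark `b` of this vertex is set. -/
def mark (L a b : ℕ) : Prog :=
  .seq (block [.op .sub 5 L 6, .op .add 5 5 5, .op .add 5 5 5, .op .add 5 5 5, .const 15 a,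
      .op .add 15 5 15, .store 15 6, .const 16 b, .op .add 16 5 16, .load 16 16])
    (.ite 16 (block [.declareFailure]) (block []))

/-- Process one hyperedge. -/
def updateProg : Prog :=
  .seq (block [.const 6 1, .const 9 0, .const 10 0, .const 11 0, .const 12 0, .const 13 0,
      .op .add 14 0 0, .op .add 14 14 14, .copy 3 0]) <|
  .seq (.while 3 processVertex) <|
  .seq (.ite 9 (mark 9 2 3) (block [])) <|
  .seq (.ite 11 (mark 11 2 3) (block [])) <|
  -- A zero in register 9 or 11 means that a color is missing, so the hyperedge is monochromatic and
  -- its first vertex gets the flip mark.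
  .ite 9 (.ite 11 (block []) (mark 13 3 2)) (mark 13 3 2)

/-- Print the color of one vertex and go to the next one. -/
def printVertex : Prog :=
  -- The test `eq` of color and flip mark yields the negated exclusive or. Both colors are thereby
  -- interchanged throughout, which does not affect properness.
  block [.op .sub 4 3 6, .op .add 5 4 4, .op .add 5 5 5, .op .add 5 5 5, .op .add 5 5 6, .load 8 5,
    .op .add 5 5 6, .op .add 5 5 6, .load 9 5, .op .eq 8 8 9, .print 4 8, .op .add 5 5 6, .load 3 5]

/-- Print the coloring. -/
def reportProg : Prog := .seq (block [.const 6 1, .copy 3 2]) (.while 3 printVertex)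

/-- The streaming algorithm. -/
def alg : StreamAlg := ⟨updateProg, reportProg⟩

/-! ### Specification of the parts of the program -/

/-- The number with leading binary digit `1` followed by the `d` bits of `ω` from position `p` on. -/
def bitsVal (ω : ℕ → Bool) (p : ℕ) : ℕ → ℕ
  | 0 => 1
  | d + 1 => 2 * bitsVal ω p d + (ω (p + d)).toNat

theorem le_bitsVal (ω : ℕ → Bool) (p d : ℕ) : 2 ^ d ≤ bitsVal ω p d := by
  induction d with
  | zero => simp [bitsVal]
  | succ d ih => rw [bitsVal, pow_succ]; omega

theorem bitsVal_lt (ω : ℕ → Bool) (p d : ℕ) : bitsVal ω p d < 2 * 2 ^ d := by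
  induction d with
  | zero => simp [bitsVal]
  | succ d ih => have := Bool.toNat_le (ω (p + d)); rw [bitsVal, pow_succ]; omega

/-- The registers outside `X` and the failure flag are the same in `s` and `s'`. -/
structure Frame (X : List ℕ) (s s' : State) : Prop where
  reg : ∀ y, y ∉ X → s'.reg y = s.reg y
  failed : s'.failed = s.failed

section Specs

variable {V : Finset ℕ} {B : ℕ} {ω : ℕ → Bool} {s : State}

theorem fetchVertex_spec (hV : ∀ u ∈ V, u < 2 ^ B) (hs : Good V B s) {u : ℕ} {l : List ℕ}
    (hi : s.input = u :: l) (hu : u ∈ V) :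
    WP V B ω fetchVertex 6 (fun s' => Frame [4, 5, 7] s s' ∧ s'.reg 4 = u ∧ s'.reg 5 = 8 * u ∧
      s'.reg 7 = s.mem (8 * u) ∧ s'.mem = s.mem ∧ s'.used = s.used ∧ s'.input = l) s := by
  have := hV u hu
  have e : 2 ^ (B + 4) = 16 * 2 ^ B := by ring
  have e8 : u + u + (u + u) + (u + u + (u + u)) = 8 * u := by ring
  refine WP.block hV hs ?_ ?_
  · simp [BlockOk, Instr.Ok, Instr.exec, hi, BinOp.eval]
    omega
  · simp [execBlock, Instr.exec, hi, BinOp.eval, e8]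
    constructor <;> simp +contextual

theorem drawWeight_spec (hV : ∀ u ∈ V, u < 2 ^ B) (hs : Good V B s) {n : ℕ} (hn : 1 ≤ n)
    (hnB : n ≤ 2 ^ B) (h0 : s.reg 0 = n) :
    WP V B ω drawWeight (Nat.clog 2 n * 7 + 5) (fun s' => Frame [7, 15, 16, 17] s s' ∧
      s'.reg 7 = bitsVal ω s.used (Nat.clog 2 n) ∧ s'.mem = s.mem ∧
      s'.used = s.used + Nat.clog 2 n ∧ s'.input = s.input) s := by
  set D := Nat.clog 2 n with hD
  have e : 2 ^ (B + 4) = 16 * 2 ^ B := by ring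
  have hpos : 0 < 2 ^ B := by positivity
  have hclog : ∀ d, 2 ^ d < n ↔ d < D := fun d => (Nat.lt_clog_iff_pow_lt (by norm_num)).symm
  let I : ℕ → State → Prop := fun j s' => ∃ d, d + j = D ∧ Frame [7, 15, 16, 17] s s' ∧
    s'.reg 15 = 2 ^ d ∧ s'.reg 16 = (if 2 ^ d < n then 1 else 0) ∧
    s'.reg 7 = bitsVal ω s.used d ∧ s'.mem = s.mem ∧ s'.used = s.used + d ∧ s'.input = s.input
  have key := WP.seq (V := V) (B := B) (ω := ω)
    (p := block [.const 7 1, .const 15 1, .op .lt 16 15 0])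
    (q := .while 16 (block [.op .add 15 15 15, .flip 17, .op .add 7 7 7, .op .add 7 7 17,
      .op .lt 16 15 0])) (k₁ := 4) (k₂ := D * 7 + 1) (Q := I 0) (s := s) ?_
  · refine key.mono (by omega) ?_
    rintro s' - ⟨d, hd, h1, -, -, h2, h3, h4, h5⟩
    obtain rfl : d = D := by omega
    exact ⟨h1, h2, h3, h4, h5⟩
  refine WP.block hV hs ?_ ?_
  · simp [BlockOk, Instr.Ok]
  intro hg
  refine WP.while hV (I := I) ?_ ?_ D hg ?_
  · rintro j s' hg' ⟨d, hd, h1, h15, h16, h7, h2, h3, h4⟩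
    have hlt := (hclog d).2 (by omega)
    rw [if_pos hlt] at h16
    refine ⟨by omega, ?_⟩
    have hb := bitsVal_lt ω s.used d
    have ht := Bool.toNat_le (ω (s.used + d))
    have h0' : s'.reg 0 = n := by rw [h1.reg 0 (by simp), h0]
    refine WP.block hV hg' ?_ ?_
    · simp [BlockOk, Instr.Ok, Instr.exec, BinOp.eval, h15, h7, h3]
      omega
    · refine ⟨d + 1, by omega, ⟨?_, ?_⟩, ?_⟩
      · intro y hy
        rw [← h1.reg y hy]
        simp at hy
        simp [execBlock, Instr.exec, hy]
      · simpa [execBlock, Instr.exec] using h1.failed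
      · simp [execBlock, Instr.exec, BinOp.eval, h15, h7, h3, h2, h4, h0', bitsVal, pow_succ]
        refine ⟨by ring, ?_, by ring, by ring⟩
        rw [mul_two]
  · rintro s' - ⟨d, hd, -, -, h16, -⟩
    rw [h16, if_neg]
    rw [hclog]
    omega
  · refine ⟨0, by omega, ⟨?_, ?_⟩, ?_⟩
    · intro y hy
      simp at hy
      simp [execBlock, Instr.exec, hy]
    · simp [execBlock, Instr.exec]
    · simp [execBlock, Instr.exec, BinOp.eval, h0, bitsVal]

theorem storeVertex_spec (hV : ∀ u ∈ V, u < 2 ^ B) (hs : Good V B s) {u : ℕ} (hu : u ∈ V)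
    (h4 : s.reg 4 = u) (h5 : s.reg 5 = 8 * u) (h6 : s.reg 6 = 1) :
    WP V B ω storeVertex 10 (fun s' => Frame [8, 15, 2] s s' ∧ s'.reg 2 = u + 1 ∧
      s'.used = s.used + 1 ∧ s'.input = s.input ∧
      ∀ a, s'.mem a = if a = 8 * u + 4 then s.reg 2 else if a = 8 * u + 1 then (ω s.used).toNat
        else if a = 8 * u then s.reg 7 else s.mem a) s := by
  have := hV u hu
  have e : 2 ^ (B + 4) = 16 * 2 ^ B := by ring
  have e8 : (8 * u + 1) / 8 = u := by omega
  have e4 : (8 * u + 1 + 1 + 1 + 1) / 8 = u := by omega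
  refine WP.block hV hs ?_ ?_
  · simp [BlockOk, Instr.Ok, Instr.exec, BinOp.eval, h4, h5, h6, e8, e4, hu]
    omega
  · refine ⟨⟨?_, ?_⟩, ?_⟩
    · intro y hy
      simp at hy
      simp [execBlock, Instr.exec, hy]
    · simp [execBlock, Instr.exec]
    · simp [execBlock, Instr.exec, BinOp.eval, h4, h5, h6, Function.update_apply]

theorem fetchColor_spec (hV : ∀ u ∈ V, u < 2 ^ B) (hs : Good V B s) {u : ℕ} (hu : u ∈ V)
    (h4 : s.reg 4 = u) (h5 : s.reg 5 = 8 * u) (h6 : s.reg 6 = 1) :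
    WP V B ω fetchColor 4 (fun s' => Frame [4, 5, 8] s s' ∧ s'.reg 4 = u + 1 ∧
      s'.reg 8 = s.mem (8 * u + 1) ∧ s'.mem = s.mem ∧ s'.used = s.used ∧ s'.input = s.input) s := by
  have := hV u hu
  have e : 2 ^ (B + 4) = 16 * 2 ^ B := by ring
  refine WP.block hV hs ?_ ?_
  · simp [BlockOk, Instr.Ok, Instr.exec, BinOp.eval, h4, h5, h6]
    omega
  · refine ⟨⟨?_, ?_⟩, ?_⟩
    · intro y hy
      simp at hy
      simp [execBlock, Instr.exec, hy]
    · simp [execBlock, Instr.exec]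
    · simp [execBlock, Instr.exec, BinOp.eval, h4, h5, h6]

theorem updateMax_spec (hV : ∀ u ∈ V, u < 2 ^ B) (hs : Good V B s) (h6 : s.reg 6 = 1) {L K : ℕ}
    (hL : 8 < L ∧ L < 15) (hK : 8 < K ∧ K < 15) (hLK : L ≠ K) :
    WP V B ω (updateMax L K) 12 (fun s' => Frame [15, 16, 17, L, K] s s' ∧
      s'.mem = s.mem ∧ s'.used = s.used ∧ s'.input = s.input ∧
      if s.reg K < s.reg 7 ∨ s.reg K = s.reg 7 ∧ s.reg L < s.reg 4 then
        s'.reg L = s.reg 4 ∧ s'.reg K = s.reg 7 else s'.reg L = s.reg L ∧ s'.reg K = s.reg K) s := by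
  have e : 2 ^ (B + 4) = 16 * 2 ^ B := by ring
  have hpos : 0 < 2 ^ B := by positivity
  have n1 : L ≠ 15 := by omega
  have n2 : L ≠ 16 := by omega
  have n3 : L ≠ 17 := by omega
  have n4 : K ≠ 15 := by omega
  have n5 : K ≠ 16 := by omega
  have n6 : K ≠ 17 := by omega
  have n7 : 7 ≠ L := by omega
  have n8 : 7 ≠ K := by omega
  refine WP.seq (k₁ := 8) (k₂ := 4) (WP.block hV hs ?_ ?_)
  · simp [BlockOk, Instr.Ok, Instr.exec, BinOp.eval, n1, n2, n4]
    split_ifs <;> omega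
  intro hg
  generalize hs1 : execBlock ω _ s = s₁ at hg ⊢
  have f1 : ∀ y, y ∉ [15, 16, 17] → s₁.reg y = s.reg y := by
    intro y hy
    simp at hy
    simp [← hs1, execBlock, Instr.exec, hy]
  have f2 : s₁.mem = s.mem ∧ s₁.used = s.used ∧ s₁.input = s.input ∧ s₁.failed = s.failed := by
    simp [← hs1, execBlock, Instr.exec]
  have f3 : s₁.reg 15 ≠ 0 ↔ s.reg K < s.reg 7 ∨ s.reg K = s.reg 7 ∧ s.reg L < s.reg 4 := by
    have : s₁.reg 15 = (if s.reg K < s.reg 7 then 1 else 0) +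
        (if s.reg K < s.reg 7 then 1 else 0) + (if s.reg K = s.reg 7 then 1 else 0) +
        (if s.reg L < s.reg 4 then 1 else 0) - 1 := by
      simp [← hs1, execBlock, Instr.exec, BinOp.eval, h6, n1, n2, n4]
    rw [this]
    split_ifs <;> omega
  refine WP.ite hg (fun h => ?_) fun h => ?_
  · refine WP.block hV hg ?_ ?_
    · simp [BlockOk, Instr.Ok]
      omega
    · rw [if_pos (f3.1 h)]
      refine ⟨⟨?_, ?_⟩, ?_⟩
      · intro y hy
        simp at hy
        simp [execBlock, Instr.exec, hy, f1]
      · simp [execBlock, Instr.exec, f2]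
      · simp [execBlock, Instr.exec, f2, hLK, n7, f1]
  · refine (WP.block hV hg (l := []) trivial ?_).mono (k₁ := 1) (by norm_num) fun _ _ h => h
    rw [if_neg fun h' => f3.2 h' h]
    refine ⟨⟨?_, ?_⟩, ?_⟩
    · intro y hy
      simp at hy
      simp [execBlock, hy, f1]
    · simp [execBlock, f2]
    · simp [execBlock, f2, f1, n1, n2, n3, n4, n5, n6]

theorem updateMin_spec (hV : ∀ u ∈ V, u < 2 ^ B) (hs : Good V B s) (h6 : s.reg 6 = 1) :
    WP V B ω updateMin 12 (fun s' => Frame [15, 16, 17, 13, 14] s s' ∧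
      s'.mem = s.mem ∧ s'.used = s.used ∧ s'.input = s.input ∧
      if s.reg 7 < s.reg 14 ∨ s.reg 7 = s.reg 14 ∧ s.reg 4 < s.reg 13 then
        s'.reg 13 = s.reg 4 ∧ s'.reg 14 = s.reg 7 else
        s'.reg 13 = s.reg 13 ∧ s'.reg 14 = s.reg 14) s := by
  have e : 2 ^ (B + 4) = 16 * 2 ^ B := by ring
  have hpos : 0 < 2 ^ B := by positivity
  refine WP.seq (k₁ := 8) (k₂ := 4) (WP.block hV hs ?_ ?_)
  · simp [BlockOk, Instr.Ok, Instr.exec, BinOp.eval]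
    split_ifs <;> omega
  intro hg
  generalize hs1 : execBlock ω _ s = s₁ at hg ⊢
  have f1 : ∀ y, y ∉ [15, 16, 17] → s₁.reg y = s.reg y := by
    intro y hy
    simp at hy
    simp [← hs1, execBlock, Instr.exec, hy]
  have f2 : s₁.mem = s.mem ∧ s₁.used = s.used ∧ s₁.input = s.input ∧ s₁.failed = s.failed := by
    simp [← hs1, execBlock, Instr.exec]
  have f3 : s₁.reg 15 ≠ 0 ↔ s.reg 7 < s.reg 14 ∨ s.reg 7 = s.reg 14 ∧ s.reg 4 < s.reg 13 := by
    have : s₁.reg 15 = (if s.reg 7 < s.reg 14 then 1 else 0) +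
        (if s.reg 7 < s.reg 14 then 1 else 0) + (if s.reg 7 = s.reg 14 then 1 else 0) +
        (if s.reg 4 < s.reg 13 then 1 else 0) - 1 := by
      simp [← hs1, execBlock, Instr.exec, BinOp.eval, h6]
    rw [this]
    split_ifs <;> omega
  refine WP.ite hg (fun h => ?_) fun h => ?_
  · refine WP.block hV hg ?_ ?_
    · simp [BlockOk, Instr.Ok]
    · rw [if_pos (f3.1 h)]
      refine ⟨⟨?_, ?_⟩, ?_⟩
      · intro y hy
        simp at hy
        simp [execBlock, Instr.exec, hy, f1]
      · simp [execBlock, Instr.exec, f2]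
      · simp [execBlock, Instr.exec, f2, f1]
  · refine (WP.block hV hg (l := []) trivial ?_).mono (k₁ := 1) (by norm_num) fun _ _ h => h
    rw [if_neg fun h' => f3.2 h' h]
    refine ⟨⟨?_, ?_⟩, ?_⟩
    · intro y hy
      simp at hy
      simp [execBlock, hy, f1]
    · simp [execBlock, f2]
    · simp [execBlock, f2, f1]

theorem mark_spec (hV : ∀ u ∈ V, u < 2 ^ B) (hs : Good V B s) {u L a b : ℕ} (hu : u ∈ V)
    (hL : s.reg L = u + 1) (h6 : s.reg 6 = 1) (ha : a < 8) (hb : b < 8) (hab : a ≠ b) :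
    WP V B ω (mark L a b) 14 (fun s' => (∀ y, y ∉ [5, 15, 16] → s'.reg y = s.reg y) ∧
      s'.used = s.used ∧ (∀ x, s'.mem x = if x = 8 * u + a then 1 else s.mem x) ∧
      (s'.failed = false ↔ s.failed = false ∧ s.mem (8 * u + b) = 0)) s := by
  have := hV u hu
  have e : 2 ^ (B + 4) = 16 * 2 ^ B := by ring
  have e8 : u + u + (u + u) + (u + u + (u + u)) = 8 * u := by ring
  have ea : (8 * u + a) / 8 = u := by omega
  refine WP.seq (k₁ := 11) (k₂ := 3) (WP.block hV hs ?_ ?_)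
  · simp [BlockOk, Instr.Ok, Instr.exec, BinOp.eval, h6, hL, e8, ea, hu]
    omega
  intro hg
  generalize hs1 : execBlock ω _ s = s₁ at hg ⊢
  have f1 : ∀ y, y ∉ [5, 15, 16] → s₁.reg y = s.reg y := by
    intro y hy
    simp at hy
    simp [← hs1, execBlock, Instr.exec, hy]
  have f2 : s₁.used = s.used ∧ s₁.failed = s.failed := by
    simp [← hs1, execBlock, Instr.exec]
  have f3 : ∀ x, s₁.mem x = if x = 8 * u + a then 1 else s.mem x := by
    simp [← hs1, execBlock, Instr.exec, BinOp.eval, h6, hL, e8, Function.update_apply]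
  have f4 : s₁.reg 16 = s.mem (8 * u + b) := by
    simp [← hs1, execBlock, Instr.exec, BinOp.eval, h6, hL, e8, hab.symm]
  refine WP.ite hg (fun h => ?_) fun h => ?_
  · refine WP.block hV hg ?_ ?_
    · simp [BlockOk, Instr.Ok]
    · refine ⟨f1, f2.1, f3, ?_⟩
      simp [execBlock, Instr.exec, ← f4, h]
  · refine (WP.block hV hg (l := []) trivial ?_).mono (k₁ := 1) (by norm_num) fun _ _ h => h
    refine ⟨f1, f2.1, f3, ?_⟩
    simp [execBlock, ← f4, h, f2]

end Specs

/-! ### The invariant of the algorithm -/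

/-- The pointer to the first element of a linked list of vertices. -/
def headPtr : List ℕ → ℕ
  | [] => 0
  | u :: _ => u + 1

/-- The vertices in the list are linked in memory, from each one to the next one. -/
def Linked (mem : ℕ → ℕ) : List ℕ → Prop
  | [] => True
  | u :: l => mem (8 * u + 4) = headPtr l ∧ Linked mem l

theorem Linked.congr {f g : ℕ → ℕ} {l : List ℕ} (h : Linked f l)
    (hfg : ∀ u ∈ l, g (8 * u + 4) = f (8 * u + 4)) : Linked g l := by
  induction l with
  | nil => trivial
  | cons u l ih =>
    exact ⟨(hfg u (by simp)).trans h.1, ih h.2 fun v hv => hfg v (by simp [hv])⟩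

/-- The vertices `vs` (the latest one first) have been discovered, `w` and `c` are their weights and
colors, and the vertices in `F` and `M` are marked as frozen and flipped, respectively. -/
structure Core (n : ℕ) (w c : ℕ → ℕ) (vs : List ℕ) (F M : Set ℕ) (s : State) : Prop where
  reg0 : s.reg 0 = n
  head : s.reg 2 = headPtr vs
  used : s.used = vs.length * (Nat.clog 2 n + 1)
  unseen : ∀ u, u ∉ vs → s.mem (8 * u) = 0
  weight : ∀ u ∈ vs, s.mem (8 * u) = w u
  color : ∀ u ∈ vs, s.mem (8 * u + 1) = c u
  frozen : ∀ u, (u ∈ F → s.mem (8 * u + 2) = 1) ∧ (u ∉ F → s.mem (8 * u + 2) = 0)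
  flipped : ∀ u, (u ∈ M → s.mem (8 * u + 3) = 1) ∧ (u ∉ M → s.mem (8 * u + 3) = 0)
  linked : Linked s.mem vs
  nodup : vs.Nodup
  -- Setting either mark tests the other one, so this equivalence holds after every marking, not
  -- only at the end of the stream.
  failed : s.failed = false ↔ Disjoint F M

theorem Core.congr {n : ℕ} {w c : ℕ → ℕ} {vs : List ℕ} {F M : Set ℕ} {s s' : State}
    (h : Core n w c vs F M s) (h0 : s'.reg 0 = s.reg 0) (h2 : s'.reg 2 = s.reg 2)
    (hu : s'.used = s.used) (hm : s'.mem = s.mem) (hf : s'.failed = s.failed) :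
    Core n w c vs F M s' := by
  obtain ⟨a1, a2, a3, a4, a5, a6, a7, a8, a9, a10, a11⟩ := h
  exact ⟨h0.trans a1, h2.trans a2, hu.trans a3, hm ▸ a4, hm ▸ a5, hm ▸ a6, hm ▸ a7, hm ▸ a8,
    hm ▸ a9, a10, hf ▸ a11⟩

/-- The order of the vertices by weight, with ties broken by name. -/
def KeyLE (w : ℕ → ℕ) (u v : ℕ) : Prop := w u < w v ∨ w u = w v ∧ u ≤ v

/-- `u` is the last vertex of color `k` in `h`. -/
def IsLast (w c : ℕ → ℕ) (k : ℕ) (h : List ℕ) (u : ℕ) : Prop :=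
  u ∈ h ∧ c u = k ∧ ∀ v ∈ h, c v = k → KeyLE w v u

/-- `u` is the first vertex of `h`. -/
def IsFirst (w : ℕ → ℕ) (h : List ℕ) (u : ℕ) : Prop := u ∈ h ∧ ∀ v ∈ h, KeyLE w u v

/-- All vertices of `h` have the same color. -/
def Mono (c : ℕ → ℕ) (h : List ℕ) : Prop := ∀ u ∈ h, ∀ v ∈ h, c u = c v

/-- `L` and `K` hold (the successor of) the last vertex of color `k` in `h` and its weight. -/
def MaxReg (w c : ℕ → ℕ) (k : ℕ) (h : List ℕ) (L K : ℕ) : Prop :=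
  -- The default (0, 0) lies below every pair (weight, u + 1), so the first vertex of color k
  -- replaces it.
  (L = 0 ∧ K = 0 ∧ ∀ u ∈ h, c u ≠ k) ∨ ∃ u, IsLast w c k h u ∧ L = u + 1 ∧ K = w u

/-- `L` and `K` hold (the successor of) the first vertex of `h` and its weight. -/
def MinReg (n : ℕ) (w : ℕ → ℕ) (h : List ℕ) (L K : ℕ) : Prop :=
  -- All weights are below 4n (`weight_lt`), so the default loses to the first vertex read.
  (L = 0 ∧ K = 4 * n ∧ h = []) ∨ ∃ u, IsFirst w h u ∧ L = u + 1 ∧ K = w u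

/-! ### Running extrema over the vertices of a hyperedge -/

theorem MaxReg.concat_of_ne {w c : ℕ → ℕ} {k L K u : ℕ} {h : List ℕ} (H : MaxReg w c k h L K)
    (hu : c u ≠ k) : MaxReg w c k (h ++ [u]) L K := by
  rcases H with ⟨h1, h2, h3⟩ | ⟨v, ⟨h1, h2, h3⟩, h4, h5⟩
  · exact .inl ⟨h1, h2, by simpa [or_imp, forall_and] using ⟨h3, hu⟩⟩
  · refine .inr ⟨v, ⟨by simp [h1], h2, fun x hx hxk => ?_⟩, h4, h5⟩
    simp only [List.mem_append, List.mem_singleton] at hx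
    rcases hx with hx | rfl
    exacts [h3 x hx hxk, absurd hxk hu]

theorem MaxReg.concat_of_lt {w c : ℕ → ℕ} {k L K u : ℕ} {h : List ℕ} (H : MaxReg w c k h L K)
    (hu : c u = k) (hlt : K < w u ∨ K = w u ∧ L < u + 1) :
    MaxReg w c k (h ++ [u]) (u + 1) (w u) := by
  refine .inr ⟨u, ⟨by simp, hu, fun x hx hxk => ?_⟩, rfl, rfl⟩
  simp only [List.mem_append, List.mem_singleton] at hx
  rcases hx with hx | rfl
  · rcases H with ⟨h1, h2, h3⟩ | ⟨v, ⟨h1, h2, h3⟩, rfl, rfl⟩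
    · exact absurd hxk (h3 x hx)
    · have := h3 x hx hxk
      unfold KeyLE at *
      omega
  · exact .inr ⟨rfl, le_rfl⟩

theorem MaxReg.concat_of_not_lt {w c : ℕ → ℕ} {k L K u : ℕ} {h : List ℕ} (H : MaxReg w c k h L K)
    (hlt : ¬(K < w u ∨ K = w u ∧ L < u + 1)) : MaxReg w c k (h ++ [u]) L K := by
  rcases H with ⟨h1, h2, h3⟩ | ⟨v, ⟨h1, h2, h3⟩, rfl, rfl⟩
  · omega
  · refine .inr ⟨v, ⟨by simp [h1], h2, fun x hx hxk => ?_⟩, rfl, rfl⟩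
    simp only [List.mem_append, List.mem_singleton] at hx
    rcases hx with hx | rfl
    · exact h3 x hx hxk
    · unfold KeyLE
      omega

theorem MinReg.concat_of_lt {n : ℕ} {w : ℕ → ℕ} {L K u : ℕ} {h : List ℕ} (H : MinReg n w h L K)
    (hlt : w u < K ∨ w u = K ∧ u + 1 < L) : MinReg n w (h ++ [u]) (u + 1) (w u) := by
  refine .inr ⟨u, ⟨by simp, fun x hx => ?_⟩, rfl, rfl⟩
  simp only [List.mem_append, List.mem_singleton] at hx
  rcases hx with hx | rfl
  · rcases H with ⟨h1, h2, rfl⟩ | ⟨v, ⟨h1, h3⟩, rfl, rfl⟩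
    · simp at hx
    · have := h3 x hx
      unfold KeyLE at *
      omega
  · exact .inr ⟨rfl, le_rfl⟩

theorem MinReg.concat_of_not_lt {n : ℕ} {w : ℕ → ℕ} {L K u : ℕ} {h : List ℕ}
    (H : MinReg n w h L K) (hu : w u < 4 * n) (hlt : ¬(w u < K ∨ w u = K ∧ u + 1 < L)) :
    MinReg n w (h ++ [u]) L K := by
  rcases H with ⟨h1, h2, rfl⟩ | ⟨v, ⟨h1, h3⟩, rfl, rfl⟩
  · omega
  · refine .inr ⟨v, ⟨by simp [h1], fun x hx => ?_⟩, rfl, rfl⟩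
    simp only [List.mem_append, List.mem_singleton] at hx
    rcases hx with hx | rfl
    · exact h3 x hx
    · unfold KeyLE
      omega

/-- The list of discovered vertices after the vertices in `h` have been presented. -/
def discover (vs h : List ℕ) : List ℕ := h.foldl (fun l u => l.insert u) vs

theorem suffix_discover (vs h : List ℕ) : vs <:+ discover vs h := by
  induction h generalizing vs with
  | nil => exact List.suffix_refl _
  | cons u h ih => exact (List.suffix_insert u vs).trans (ih _)

theorem mem_discover {vs h : List ℕ} {u : ℕ} : u ∈ discover vs h ↔ u ∈ vs ∨ u ∈ h := by
  induction h generalizing vs with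
  | nil => simp [discover]
  | cons v h ih =>
    change u ∈ discover (vs.insert v) h ↔ _
    rw [ih, List.mem_insert_iff, List.mem_cons]
    tauto

theorem nodup_discover {vs : List ℕ} (h : List ℕ) (hvs : vs.Nodup) : (discover vs h).Nodup := by
  induction h generalizing vs with
  | nil => exact hvs
  | cons v h ih => exact ih hvs.insert

theorem discover_append (vs h h' : List ℕ) :
    discover vs (h ++ h') = discover (discover vs h) h' := List.foldl_append ..

/-- The weights and colors of the vertices in `vs` are those that the algorithm draws from `ω`. -/
def Drawn (n : ℕ) (ω : ℕ → Bool) (w c : ℕ → ℕ) (vs : List ℕ) : Prop :=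
  -- Here l consists of the vertices discovered before u, each of which used `Nat.clog 2 n` bits for
  -- its weight and one for its color.
  ∀ u l, u :: l <:+ vs →
    w u = bitsVal ω (l.length * (Nat.clog 2 n + 1)) (Nat.clog 2 n) ∧
    c u = (ω (l.length * (Nat.clog 2 n + 1) + Nat.clog 2 n)).toNat

theorem Drawn.of_suffix {n : ℕ} {ω : ℕ → Bool} {w c : ℕ → ℕ} {vs vs' : List ℕ}
    (h : Drawn n ω w c vs') (hs : vs <:+ vs') : Drawn n ω w c vs :=
  fun u l hl => h u l (hl.trans hs)

/-- The invariant of the loop that processes the vertices of a hyperedge. -/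
structure EdgeInv (n : ℕ) (w c : ℕ → ℕ) (h vs : List ℕ) (F M : Set ℕ) (s : State) : Prop where
  core : Core n w c vs F M s
  reg6 : s.reg 6 = 1
  max0 : MaxReg w c 0 h (s.reg 9) (s.reg 10)
  max1 : MaxReg w c 1 h (s.reg 11) (s.reg 12)
  min : MinReg n w h (s.reg 13) (s.reg 14)

/-! ### Correctness of the update and of the report -/

section Specs

variable {V : Finset ℕ} {B : ℕ} {ω : ℕ → Bool} {s : State} {n : ℕ} {w c : ℕ → ℕ} {vs : List ℕ}
  {F M : Set ℕ}

/-- Since weights are positive, a zero weight cell recognizes a new vertex. Only then are bits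
consumed, and `Core.used` places them exactly where `Drawn` expects them. -/
theorem discoverVertex_spec (hV : ∀ u ∈ V, u < 2 ^ B) (hs : Good V B s) (hn : 1 ≤ n)
    (hnB : n ≤ 2 ^ B) {u : ℕ} {l : List ℕ} (hi : s.input = u :: l) (hu : u ∈ V)
    (hw : ∀ u, 0 < w u) (h6 : s.reg 6 = 1) (hC : Core n w c vs F M s)
    (hD : Drawn n ω w c (vs.insert u)) :
    WP V B ω (.seq fetchVertex (.ite 7 (block []) (.seq drawWeight storeVertex)))
      (7 * Nat.clog 2 n + 22) (fun s' => (∀ y, y ∉ [2, 4, 5, 7, 8, 15, 16, 17] →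
        s'.reg y = s.reg y) ∧ s'.reg 4 = u ∧ s'.reg 5 = 8 * u ∧ s'.reg 7 = w u ∧
        s'.input = l ∧ Core n w c (vs.insert u) F M s') s := by
  refine (WP.seq (k₂ := 7 * Nat.clog 2 n + 15 + 1)
    ((fetchVertex_spec hV hs hi hu).mono le_rfl ?_)).mono (by omega) fun _ _ h => h
  rintro s₁ hg ⟨f1, a4, a5, a7, am, au, ai⟩ -
  have hC₁ : Core n w c vs F M s₁ :=
    hC.congr (f1.reg _ (by simp)) (f1.reg _ (by simp)) au am f1.failed
  refine WP.ite hg (fun h7 => ?_) fun h7 => ?_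
  · have hmem : u ∈ vs := by
      by_contra hc
      exact h7 (a7.trans (hC.unseen u hc))
    rw [List.insert_of_mem hmem]
    refine (WP.block hV hg (l := []) trivial ?_).mono (k₁ := 1) (by omega) fun _ _ h => h
    refine ⟨fun y hy => f1.reg y (by simp at hy ⊢; tauto), a4, a5, ?_, ai, hC₁⟩
    exact a7.trans (hC.weight u hmem)
  · have hmem : u ∉ vs := by
      intro hc
      have := hC.weight u hc
      have := hw u
      omega
    rw [List.insert_of_not_mem hmem] at hD ⊢
    refine (WP.seq (k₂ := 10) ((drawWeight_spec hV hg hn hnB hC₁.reg0).mono le_rfl ?_)).mono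
      (by omega) fun _ _ h => h
    rintro s₂ hg₂ ⟨f2, b7, bm, bu, bi⟩ -
    refine (storeVertex_spec hV hg₂ (u := u) hu (by rw [f2.reg _ (by simp), a4])
      (by rw [f2.reg _ (by simp), a5])
      (by rw [f2.reg _ (by simp), f1.reg _ (by simp), h6])).mono le_rfl ?_
    rintro s₃ hg₃ ⟨f3, d2, du, di, dm⟩
    obtain ⟨hwu, hcu⟩ := hD u vs (List.suffix_refl _)
    have hreg : ∀ y, y ∉ [2, 4, 5, 7, 8, 15, 16, 17] → s₃.reg y = s.reg y := fun y hy => by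
      simp only [List.mem_cons, List.not_mem_nil, not_or, or_false] at hy
      rw [f3.reg y (by simp; tauto), f2.reg y (by simp; tauto), f1.reg y (by simp; tauto)]
    have h73 : s₂.reg 7 = w u := by rw [b7, hwu, hC₁.used]
    have hm2 : s₂.mem = s.mem := bm.trans am
    have hother : ∀ v, v ≠ u → ∀ i < 8, s₃.mem (8 * v + i) = s.mem (8 * v + i) :=
      fun v hv i hi => by
        rw [dm, if_neg (by omega), if_neg (by omega), if_neg (by omega), hm2]
    have hmark : ∀ v, ∀ i < 8, i ≠ 0 → i ≠ 1 → i ≠ 4 → s₃.mem (8 * v + i) = s.mem (8 * v + i) :=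
      fun v i hi h0 h1 h4 => by
        rw [dm, if_neg (by omega), if_neg (by omega), if_neg (by omega), hm2]
    refine ⟨hreg, by rw [f3.reg _ (by simp), f2.reg _ (by simp), a4],
      by rw [f3.reg _ (by simp), f2.reg _ (by simp), a5], ?_, by rw [di, bi, ai], ?_⟩
    · rw [f3.reg _ (by simp), h73]
    · refine ⟨by rw [hreg _ (by simp), hC.reg0], by rw [d2, headPtr], ?_, ?_, ?_, ?_, ?_, ?_, ?_,
        List.nodup_cons.2 ⟨hmem, hC.nodup⟩, ?_⟩
      · rw [du, bu, hC₁.used, List.length_cons]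
        ring
      · intro v hv
        simp only [List.mem_cons, not_or] at hv
        exact (hother v hv.1 0 (by omega)).trans (hC.unseen v hv.2)
      · intro v hv
        by_cases hvu : v = u
        · subst hvu
          rw [dm, if_neg (by omega), if_neg (by omega), if_pos rfl, h73]
        · exact (hother v hvu 0 (by omega)).trans
            (hC.weight v ((List.mem_cons.1 hv).resolve_left hvu))
      · intro v hv
        by_cases hvu : v = u
        · subst hvu
          rw [dm, if_neg (by omega), if_pos rfl, bu, hC₁.used, hcu]
        · exact (hother v hvu 1 (by omega)).trans
            (hC.color v ((List.mem_cons.1 hv).resolve_left hvu))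
      · intro v
        rw [hmark v 2 (by omega) (by omega) (by omega) (by omega)]
        exact hC.frozen v
      · intro v
        rw [hmark v 3 (by omega) (by omega) (by omega) (by omega)]
        exact hC.flipped v
      · refine ⟨?_, hC.linked.congr fun v hv => hother v ?_ 4 (by omega)⟩
        · rw [dm, if_pos rfl, f2.reg _ (by simp), f1.reg _ (by simp), hC.head]
        · rintro rfl
          exact hmem hv
      · rw [f3.failed, f2.failed, f1.failed]
        exact hC.failed

theorem processVertex_spec (hV : ∀ u ∈ V, u < 2 ^ B) (hs : Good V B s) (hn : 1 ≤ n)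
    (hnB : n ≤ 2 ^ B) {u : ℕ} {l h : List ℕ} (hi : s.input = u :: l) (hu : u ∈ V)
    (hw : ∀ u, 0 < w u) (hw' : ∀ u, w u < 4 * n) (hc : ∀ u, c u ≤ 1)
    (hE : EdgeInv n w c h vs F M s) (hD : Drawn n ω w c (vs.insert u)) :
    WP V B ω processVertex (7 * Nat.clog 2 n + 53) (fun s' => s'.reg 3 = s.reg 3 - 1 ∧
        s'.input = l ∧ EdgeInv n w c (h ++ [u]) (vs.insert u) F M s') s := by
  obtain ⟨hC, h6, hmax0, hmax1, hmin⟩ := hE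
  have start := discoverVertex_spec hV hs hn hnB hi hu hw h6 hC hD
  -- Regrouping the sequence changes neither time nor space, and lets `discoverVertex_spec` cover
  -- the first two parts.
  have assoc : ∀ {p q r : Prog} {k : ℕ} {Q : State → Prop},
      WP V B ω (.seq (.seq p q) r) k Q s → WP V B ω (.seq p (.seq q r)) k Q s := by
    rintro p q r k Q ⟨s', t, m, h1, h2⟩
    cases h1 with
    | seq h1 h1' =>
      cases h1 with
      | seq a b =>
        have := Exec.seq a (.seq b h1')
        rw [← add_assoc, ← max_assoc] at this
        exact ⟨_, _, _, this, h2⟩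
  refine assoc ((WP.seq (k₂ := 31) (start.mono le_rfl ?_)).mono (by omega) fun _ _ h => h)
  rintro s₁ hg₁ ⟨f1, a4, a5, a7, ai, hC₁⟩ -
  have h61 : s₁.reg 6 = 1 := by rw [f1 _ (by simp), h6]
  refine (WP.seq (k₂ := 27) ((fetchColor_spec hV hg₁ hu a4 a5 h61).mono le_rfl ?_)).mono
    (by omega) fun _ _ h => h
  rintro s₂ hg₂ ⟨f2, b4, b8, bm, bu, bi⟩ -
  rw [hC₁.color u (by simp)] at b8
  have h62 : s₂.reg 6 = 1 := by rw [f2.reg _ (by simp), h61]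
  have h72 : s₂.reg 7 = w u := by rw [f2.reg _ (by simp), a7]
  have hC₂ : Core n w c (vs.insert u) F M s₂ :=
    hC₁.congr (f2.reg _ (by simp)) (f2.reg _ (by simp)) bu bm f2.failed
  have old : ∀ y, y ∉ [2, 4, 5, 7, 8, 15, 16, 17] → s₂.reg y = s.reg y := fun y hy => by
    rw [f2.reg y (by simp at hy ⊢; tauto), f1 y hy]
  refine (WP.seq (k₁ := 12 + 1) (k₂ := 14) (WP.mono (k₁ := 12 + 1)
    (Q := fun s' => Core n w c (vs.insert u) F M s' ∧ s'.reg 6 = 1 ∧ s'.reg 7 = w u ∧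
      s'.reg 4 = u + 1 ∧ s'.reg 3 = s.reg 3 ∧ s'.input = l ∧
      s'.reg 13 = s.reg 13 ∧ s'.reg 14 = s.reg 14 ∧
      MaxReg w c 0 (h ++ [u]) (s'.reg 9) (s'.reg 10) ∧
      MaxReg w c 1 (h ++ [u]) (s'.reg 11) (s'.reg 12)) ?_ le_rfl ?_)).mono
      (by omega) fun _ _ h => h
  · have hc1 := hc u
    refine WP.ite hg₂ (fun h8 => ?_) fun h8 => ?_
    · refine (updateMax_spec hV hg₂ h62 (by omega) (by omega) (by omega)).mono le_rfl ?_
      rintro s₃ hg₃ ⟨f3, cm, cu, ci, hif⟩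
      refine ⟨hC₂.congr (f3.reg _ (by simp)) (f3.reg _ (by simp)) cu cm f3.failed,
        by rw [f3.reg _ (by simp), h62], by rw [f3.reg _ (by simp), h72],
        by rw [f3.reg _ (by simp), b4], by rw [f3.reg _ (by simp), old _ (by simp)],
        by rw [ci, bi, ai], by rw [f3.reg _ (by simp), old _ (by simp)],
        by rw [f3.reg _ (by simp), old _ (by simp)], ?_, ?_⟩
      · rw [f3.reg 9 (by simp), f3.reg 10 (by simp), old 9 (by simp), old 10 (by simp)]
        exact hmax0.concat_of_ne (by omega)
      · rw [h72, b4, old 11 (by simp), old 12 (by simp)] at hif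
        split_ifs at hif with hlt
        · rw [hif.1, hif.2]
          exact hmax1.concat_of_lt (by omega) hlt
        · rw [hif.1, hif.2]
          exact hmax1.concat_of_not_lt hlt
    · refine (updateMax_spec hV hg₂ h62 (by omega) (by omega) (by omega)).mono le_rfl ?_
      rintro s₃ hg₃ ⟨f3, cm, cu, ci, hif⟩
      refine ⟨hC₂.congr (f3.reg _ (by simp)) (f3.reg _ (by simp)) cu cm f3.failed,
        by rw [f3.reg _ (by simp), h62], by rw [f3.reg _ (by simp), h72],
        by rw [f3.reg _ (by simp), b4], by rw [f3.reg _ (by simp), old _ (by simp)],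
        by rw [ci, bi, ai], by rw [f3.reg _ (by simp), old _ (by simp)],
        by rw [f3.reg _ (by simp), old _ (by simp)], ?_, ?_⟩
      · rw [h72, b4, old 9 (by simp), old 10 (by simp)] at hif
        split_ifs at hif with hlt
        · rw [hif.1, hif.2]
          exact hmax0.concat_of_lt (by omega) hlt
        · rw [hif.1, hif.2]
          exact hmax0.concat_of_not_lt hlt
      · rw [f3.reg 11 (by simp), f3.reg 12 (by simp), old 11 (by simp), old 12 (by simp)]
        exact hmax1.concat_of_ne (by omega)
  rintro s₃ hg₃ ⟨hC₃, h63, h73, h43, h33, hi3, h13, h14, m0, m1⟩ -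
  refine WP.seq (k₁ := 12) (k₂ := 2) ((updateMin_spec hV hg₃ h63).mono le_rfl ?_)
  rintro s₄ hg₄ ⟨f4, dm, du, di, hif⟩ -
  have h64 : s₄.reg 6 = 1 := by rw [f4.reg _ (by simp), h63]
  have h34 : s₄.reg 3 = s.reg 3 := by rw [f4.reg _ (by simp), h33]
  refine WP.block hV hg₄ (by simp [BlockOk, Instr.Ok]) ?_
  simp only [execBlock, Instr.exec, BinOp.eval, h64, h34]
  refine ⟨by simp, by simp [di, hi3], ?_, by simp [h64], ?_, ?_, ?_⟩
  · refine hC₃.congr ?_ ?_ (by simp [du]) (by simp [dm]) (by simp [f4.failed])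
    · simp [f4.reg]
    · simp [f4.reg]
  · simpa [f4.reg] using m0
  · simpa [f4.reg] using m1
  · rw [h73, h43, h13, h14] at hif
    have e13 : ∀ k, (s₄.set 3 k).reg 13 = s₄.reg 13 := by simp
    have e14 : ∀ k, (s₄.set 3 k).reg 14 = s₄.reg 14 := by simp
    rw [e13, e14]
    split_ifs at hif with hlt
    · rw [hif.1, hif.2]
      exact hmin.concat_of_lt hlt
    · rw [hif.1, hif.2]
      exact hmin.concat_of_not_lt (hw' u) hlt

/-- Disjointness survives the insertion of u into F exactly if u ∉ M, and this is what the cell 8u +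
3 records. -/
theorem Core.freeze (hC : Core n w c vs F M s) {s' : State} {u : ℕ} (h0 : s'.reg 0 = s.reg 0)
    (h2 : s'.reg 2 = s.reg 2) (hu : s'.used = s.used)
    (hm : ∀ x, s'.mem x = if x = 8 * u + 2 then 1 else s.mem x)
    (hf : s'.failed = false ↔ s.failed = false ∧ s.mem (8 * u + 3) = 0) :
    Core n w c vs (insert u F) M s' := by
  have hmem : ∀ v, ∀ i < 8, i ≠ 2 → s'.mem (8 * v + i) = s.mem (8 * v + i) :=
    fun v i hi hi2 => by rw [hm, if_neg (by omega)]
  refine ⟨h0.trans hC.reg0, h2.trans hC.head, hu.trans hC.used,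
    fun v hv => (hmem v 0 (by omega) (by omega)).trans (hC.unseen v hv),
    fun v hv => (hmem v 0 (by omega) (by omega)).trans (hC.weight v hv),
    fun v hv => (hmem v 1 (by omega) (by omega)).trans (hC.color v hv), fun v => ?_,
    fun v => ?_, hC.linked.congr fun v _ => hmem v 4 (by omega) (by omega), hC.nodup, ?_⟩
  · rw [hm]
    by_cases hvu : v = u
    · simp [hvu]
    · rw [if_neg (by omega), Set.mem_insert_iff]
      simpa [hvu] using hC.frozen v
  · rw [hmem v 3 (by omega) (by omega)]
    exact hC.flipped v
  · rw [hf, Set.disjoint_insert_left, hC.failed, and_comm]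
    refine and_congr_left' ⟨fun h h' => ?_, fun h => (hC.flipped u).2 h⟩
    rw [(hC.flipped u).1 h'] at h
    omega

theorem Core.flip (hC : Core n w c vs F M s) {s' : State} {u : ℕ} (h0 : s'.reg 0 = s.reg 0)
    (h2 : s'.reg 2 = s.reg 2) (hu : s'.used = s.used)
    (hm : ∀ x, s'.mem x = if x = 8 * u + 3 then 1 else s.mem x)
    (hf : s'.failed = false ↔ s.failed = false ∧ s.mem (8 * u + 2) = 0) :
    Core n w c vs F (insert u M) s' := by
  have hmem : ∀ v, ∀ i < 8, i ≠ 3 → s'.mem (8 * v + i) = s.mem (8 * v + i) :=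
    fun v i hi hi2 => by rw [hm, if_neg (by omega)]
  refine ⟨h0.trans hC.reg0, h2.trans hC.head, hu.trans hC.used,
    fun v hv => (hmem v 0 (by omega) (by omega)).trans (hC.unseen v hv),
    fun v hv => (hmem v 0 (by omega) (by omega)).trans (hC.weight v hv),
    fun v hv => (hmem v 1 (by omega) (by omega)).trans (hC.color v hv), fun v => ?_,
    fun v => ?_, hC.linked.congr fun v _ => hmem v 4 (by omega) (by omega), hC.nodup, ?_⟩
  · rw [hmem v 2 (by omega) (by omega)]
    exact hC.frozen v
  · rw [hm]
    by_cases hvu : v = u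
    · simp [hvu]
    · rw [if_neg (by omega), Set.mem_insert_iff]
      simpa [hvu] using hC.flipped v
  · rw [hf, Set.disjoint_insert_right, hC.failed, and_comm]
    refine and_congr_left' ⟨fun h h' => ?_, fun h => (hC.frozen u).2 h⟩
    rw [(hC.frozen u).1 h'] at h
    omega

/-- Breaking ties by name makes the order antisymmetric on vertices, so marking the one vertex kept
in a register marks the whole set of last vertices of that color. -/
theorem IsLast.eq {k u v : ℕ} {h : List ℕ} (hu : IsLast w c k h u) (hv : IsLast w c k h v) :
    u = v := by
  have h1 := hu.2.2 v hv.1 hv.2.1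
  have h2 := hv.2.2 u hu.1 hu.2.1
  unfold KeyLE at *
  omega

theorem IsFirst.eq {u v : ℕ} {h : List ℕ} (hu : IsFirst w h u) (hv : IsFirst w h v) : u = v := by
  have h1 := hu.2 v hv.1
  have h2 := hv.2 u hu.1
  unfold KeyLE at *
  omega

theorem freeze_spec (hV : ∀ u ∈ V, u < 2 ^ B) (hs : Good V B s) {h : List ℕ}
    (hh : ∀ u ∈ h, u ∈ V) (hC : Core n w c vs F M s) (h6 : s.reg 6 = 1) {L K k : ℕ}
    (hL : MaxReg w c k h (s.reg L) K) :
    WP V B ω (.ite L (mark L 2 3) (block [])) 15 (fun s' =>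
      (∀ y, y ∉ [5, 15, 16] → s'.reg y = s.reg y) ∧
      Core n w c vs (F ∪ {u | IsLast w c k h u}) M s') s := by
  refine WP.ite (k := 14) hs (fun hx => ?_) fun hx => ?_
  · obtain ⟨hL, -⟩ | ⟨u, hu, hLu, -⟩ := hL
    · exact absurd hL hx
    refine (mark_spec hV hs (hh u hu.1) hLu h6 (by omega) (by omega) (by omega)).mono le_rfl ?_
    rintro s' - ⟨f, fu, fm, ff⟩
    have : F ∪ {u | IsLast w c k h u} = insert u F := by
      ext v
      simp only [Set.mem_union, Set.mem_ofPred_eq, Set.mem_insert_iff]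
      exact ⟨fun hv => hv.elim .inr fun hv => .inl (hv.eq hu),
        fun hv => hv.elim (fun hv => .inr (hv ▸ hu)) .inl⟩
    rw [this]
    exact ⟨f, hC.freeze (f _ (by simp)) (f _ (by simp)) fu fm ff⟩
  · obtain ⟨-, -, hL⟩ | ⟨u, hu, hLu, -⟩ := hL
    · refine (WP.block hV hs (l := []) trivial ?_).mono (k₁ := 1) (by omega) fun _ _ h => h
      have : {u | IsLast w c k h u} = ∅ := by
        ext v
        simp only [Set.mem_ofPred_eq, Set.mem_empty_iff_false, iff_false]
        exact fun hv => hL v hv.1 hv.2.1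
      rw [this, Set.union_empty]
      exact ⟨fun _ _ => rfl, hC⟩
    · omega

theorem flip_spec (hV : ∀ u ∈ V, u < 2 ^ B) (hs : Good V B s) {h : List ℕ}
    (hh : ∀ u ∈ h, u ∈ V) (hne : h ≠ []) (hC : Core n w c vs F M s) (h6 : s.reg 6 = 1) {K : ℕ}
    (hL : MinReg n w h (s.reg 13) K) (hm : Mono c h) :
    WP V B ω (mark 13 3 2) 14 (fun s' =>
      Core n w c vs F (M ∪ {u | Mono c h ∧ IsFirst w h u}) s') s := by
  obtain ⟨-, -, hL⟩ | ⟨u, hu, hLu, -⟩ := hL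
  · exact absurd hL hne
  refine (mark_spec hV hs (hh u hu.1) hLu h6 (by omega) (by omega) (by omega)).mono le_rfl ?_
  rintro s' - ⟨f, fu, fm, ff⟩
  have : M ∪ {u | Mono c h ∧ IsFirst w h u} = insert u M := by
    ext v
    simp only [Set.mem_union, Set.mem_ofPred_eq, Set.mem_insert_iff]
    exact ⟨fun hv => hv.elim .inr fun hv => .inl (hv.2.eq hu),
      fun hv => hv.elim (fun hv => .inr (hv ▸ ⟨hm, hu⟩)) .inl⟩
  rw [this]
  exact hC.flip (f _ (by simp)) (f _ (by simp)) fu fm ff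

theorem processVertices_spec (hV : ∀ u ∈ V, u < 2 ^ B) (hs : Good V B s) (hn : 1 ≤ n)
    (hnB : n ≤ 2 ^ B) {h : List ℕ} (hh : ∀ u ∈ h, u ∈ V) (hw : ∀ u, 0 < w u)
    (hw' : ∀ u, w u < 4 * n) (hc : ∀ u, c u ≤ 1) (hD : Drawn n ω w c (discover vs h))
    (hi : s.input = h) (h3 : s.reg 3 = h.length) (hE : EdgeInv n w c [] vs F M s) :
    WP V B ω (.while 3 processVertex) (h.length * (7 * Nat.clog 2 n + 54) + 1) (fun s' =>
      EdgeInv n w c h (discover vs h) F M s') s := by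
  let I : ℕ → State → Prop := fun j s' => s'.reg 3 = j ∧ ∃ pre rest, h = pre ++ rest ∧
    rest.length = j ∧ s'.input = rest ∧ EdgeInv n w c pre (discover vs pre) F M s'
  refine (WP.while hV (I := I) (k := 7 * Nat.clog 2 n + 53) ?_ (fun s' _ h => h.1) h.length hs
    ⟨h3, [], h, rfl, rfl, hi, hE⟩).mono le_rfl ?_
  · rintro j s' hg ⟨h3, pre, rest, rfl, hj, hi, hE⟩
    refine ⟨by omega, ?_⟩
    obtain _ | ⟨u, l⟩ := rest
    · simp at hj
    have hsnoc : discover vs (pre ++ [u]) = (discover vs pre).insert u := by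
      rw [discover_append]
      rfl
    refine (processVertex_spec hV hg hn hnB hi (hh u (by simp)) hw hw' hc hE ?_).mono le_rfl ?_
    · refine hD.of_suffix ?_
      rw [← hsnoc, show pre ++ u :: l = (pre ++ [u]) ++ l by simp, discover_append vs (pre ++ [u])]
      exact suffix_discover _ _
    · rintro s₂ - ⟨h3', hi', hE'⟩
      refine ⟨by omega, pre ++ [u], l, by simp, by simpa using hj, hi', ?_⟩
      rwa [hsnoc]
  · rintro s' - ⟨-, pre, rest, rfl, hj, -, hE⟩
    obtain rfl := List.length_eq_zero_iff.1 hj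
    simpa using hE

theorem update_spec (hV : ∀ u ∈ V, u < 2 ^ B) (hs : Good V B s) (hn : 1 ≤ n) (hnB : n ≤ 2 ^ B)
    {h : List ℕ} (hh : ∀ u ∈ h, u ∈ V) (hlen : h.length = n) (hw : ∀ u, 0 < w u)
    (hw' : ∀ u, w u < 4 * n) (hc : ∀ u, c u ≤ 1) (hD : Drawn n ω w c (discover vs h))
    (hi : s.input = h) (hC : Core n w c vs F M s) :
    WP V B ω updateProg (n * (7 * Nat.clog 2 n + 54) + 58) (fun s' =>
      Core n w c (discover vs h) (F ∪ {u | ∃ k, IsLast w c k h u})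
        (M ∪ {u | Mono c h ∧ IsFirst w h u}) s') s := by
  have e : 2 ^ (B + 4) = 16 * 2 ^ B := by ring
  have hne : h ≠ [] := by
    rintro rfl
    simp at hlen
    omega
  refine (WP.seq (k₁ := 10) (k₂ := n * (7 * Nat.clog 2 n + 54) + 48)
    (WP.block hV hs ?_ ?_)).mono (by omega) fun _ _ h => h
  · simp [BlockOk, Instr.Ok, Instr.exec, BinOp.eval, hC.reg0]
    omega
  intro hg
  generalize hs1 : execBlock ω _ s = s₁ at hg ⊢
  have hE : EdgeInv n w c [] vs F M s₁ := by
    subst hs1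
    refine ⟨hC.congr ?_ ?_ ?_ ?_ ?_, ?_, .inl ?_, .inl ?_, .inl ?_⟩ <;>
      simp [execBlock, Instr.exec, BinOp.eval, hC.reg0]
    omega
  have h31 : s₁.reg 3 = h.length := by
    simp [← hs1, execBlock, Instr.exec, hC.reg0, hlen]
  have hi1 : s₁.input = h := by
    simp [← hs1, execBlock, Instr.exec, hi]
  refine (WP.seq (k₂ := 47) ((processVertices_spec hV hg hn hnB hh hw hw' hc hD hi1 h31 hE).mono
    le_rfl ?_)).mono (by rw [hlen]) fun _ _ h => h
  rintro s₂ hg₂ ⟨hC₂, h62, max0, max1, hmin⟩ -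
  refine (WP.seq (k₂ := 32) ((freeze_spec hV hg₂ hh hC₂ h62 max0).mono le_rfl ?_)).mono
    (by omega) fun _ _ h => h
  rintro s₃ hg₃ ⟨f3, hC₃⟩ -
  rw [← f3 11 (by simp)] at max1
  refine (WP.seq (k₂ := 17) ((freeze_spec hV hg₃ hh hC₃ (by rw [f3 _ (by simp), h62])
    max1).mono le_rfl ?_)).mono (by omega) fun _ _ h => h
  rintro s₄ hg₄ ⟨f4, hC₄⟩ -
  have hF : F ∪ {u | IsLast w c 0 h u} ∪ {u | IsLast w c 1 h u} =
      F ∪ {u | ∃ k, IsLast w c k h u} := by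
    rw [Set.union_assoc]
    congr 1
    ext u
    simp only [Set.mem_union, Set.mem_ofPred_eq]
    refine ⟨fun hu => hu.elim (fun h => ⟨_, h⟩) fun h => ⟨_, h⟩, ?_⟩
    rintro ⟨k, hk⟩
    have hck := hc u
    have hk1 := hk.2.1
    obtain rfl | rfl : k = 0 ∨ k = 1 := by omega
    exacts [.inl hk, .inr hk]
  rw [hF] at hC₄
  have h64 : s₄.reg 6 = 1 := by rw [f4 _ (by simp), f3 _ (by simp), h62]
  rw [← f3 13 (by simp), ← f4 13 (by simp)] at hmin
  rw [← f4 11 (by simp)] at max1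
  rw [← f3 9 (by simp), ← f4 9 (by simp)] at max0
  have mono_of : ∀ {k L K : ℕ}, MaxReg w c k h L K → L = 0 → k ≤ 1 → Mono c h := by
    rintro k L K (⟨-, -, hk⟩ | ⟨u, -, hu, -⟩) hL hk1
    · intro u hu v hv
      have := hk u hu
      have := hk v hv
      have := hc u
      have := hc v
      omega
    · omega
  refine (WP.ite (k := 15) hg₄ (fun h9 => WP.ite (k := 14) hg₄ (fun h11 => ?_) fun h11 => ?_)
    fun h9 => ?_).mono (by omega) fun _ _ h => h
  · refine (WP.block hV hg₄ (l := []) trivial ?_).mono (k₁ := 1) (by omega) fun _ _ h => h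
    obtain ⟨h0, -⟩ | ⟨u, hu, -⟩ := max0
    · exact absurd h0 h9
    obtain ⟨h0, -⟩ | ⟨v, hv, -⟩ := max1
    · exact absurd h0 h11
    have : {u | Mono c h ∧ IsFirst w h u} = ∅ := by
      ext x
      simp only [Set.mem_ofPred_eq, Set.mem_empty_iff_false, iff_false]
      rintro ⟨hm, -⟩
      have := hm u hu.1 v hv.1
      rw [hu.2.1, hv.2.1] at this
      omega
    rw [this, Set.union_empty]
    exact hC₄
  · exact flip_spec hV hg₄ hh hne hC₄ h64 hmin (mono_of max1 h11 le_rfl)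
  · exact (flip_spec hV hg₄ hh hne hC₄ h64 hmin (mono_of max0 h9 (by omega))).mono (by omega)
      fun _ _ h => h

/-- The functions w and c are fixed in advance for the whole stream. Discovery only prepends
vertices, so `Drawn` for the final list restricts to every intermediate one. -/
theorem pass_spec (hV : ∀ u ∈ V, u < 2 ^ B) (hn : 1 ≤ n) (hnB : n ≤ 2 ^ B)
    (hw : ∀ u, 0 < w u) (hw' : ∀ u, w u < 4 * n) (hc : ∀ u, c u ≤ 1) (S : List (List ℕ))
    (hS : ∀ h ∈ S, h.length = n ∧ ∀ u ∈ h, u ∈ V) (hs : Good V B s)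
    (hD : Drawn n ω w c (discover vs S.flatten)) (hC : Core n w c vs F M s) :
    ∃ s' t m, alg.Pass ω s S s' t m ∧
      t ≤ (n * (7 * Nat.clog 2 n + 54) + 58) * (2 * B + 9) ∧ m ≤ spaceBound V B ∧ Good V B s' ∧
      Core n w c (discover vs S.flatten) (F ∪ {u | ∃ h ∈ S, ∃ k, IsLast w c k h u})
        (M ∪ {u | ∃ h ∈ S, Mono c h ∧ IsFirst w h u}) s' := by
  induction S generalizing s vs F M with
  | nil => exact ⟨s, 0, _, .nil s, by omega, hs.space_le hV, hs, by simpa [discover] using hC⟩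
  | cons h S ih =>
    rw [List.flatten_cons, discover_append] at hD ⊢
    obtain ⟨hlen, hh⟩ := hS h (by simp)
    obtain ⟨s₁, t₁, m₁, e₁, ht₁, hm₁, hg₁, hC₁⟩ := update_spec (s := { s with input := h }) hV
      (hs.congr rfl rfl) hn hnB hh hlen hw hw' hc (hD.of_suffix (suffix_discover _ _)) rfl
      (hC.congr rfl rfl rfl rfl rfl)
    obtain ⟨s₂, t₂, m₂, e₂, ht₂, hm₂, hg₂, hC₂⟩ := ih (fun h' hh' => hS h' (by simp [hh'])) hg₁
      hD hC₁
    refine ⟨s₂, _, _, .cons e₁ e₂, max_le ht₁ ht₂, max_le hm₁ hm₂, hg₂, ?_⟩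
    have e1 : F ∪ {u | ∃ k, IsLast w c k h u} ∪ {u | ∃ h ∈ S, ∃ k, IsLast w c k h u} =
        F ∪ {u | ∃ h' ∈ h :: S, ∃ k, IsLast w c k h' u} := by
      ext u
      simp [or_assoc]
    have e2 : M ∪ {u | Mono c h ∧ IsFirst w h u} ∪ {u | ∃ h ∈ S, Mono c h ∧ IsFirst w h u} =
        M ∪ {u | ∃ h' ∈ h :: S, Mono c h' ∧ IsFirst w h' u} := by
      ext u
      simp [or_assoc]
    rwa [← e1, ← e2]

open Classical in
/-- The color of `u` in the maintained coloring. -/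
noncomputable def finalColor (c : ℕ → ℕ) (M : Set ℕ) (u : ℕ) : ℕ :=
  if c u = if u ∈ M then 1 else 0 then 1 else 0

open Classical in
theorem report_spec (hV : ∀ u ∈ V, u < 2 ^ B) (hs : Good V B s) (hvs : ∀ u ∈ vs, u ∈ V)
    (hC : Core n w c vs F M s) (ho : s.out = []) :
    WP V B ω reportProg (vs.length * 15 + 4) (fun s' =>
      s'.out = vs.map fun u => (u, finalColor c M u)) s := by
  have e : 2 ^ (B + 4) = 16 * 2 ^ B := by ring
  let I : ℕ → State → Prop := fun j s' => ∃ pre rest, vs = pre ++ rest ∧ rest.length = j ∧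
    s'.reg 3 = headPtr rest ∧ s'.reg 6 = 1 ∧ Linked s.mem rest ∧ s'.mem = s.mem ∧
    s'.out = pre.map fun u => (u, finalColor c M u)
  refine (WP.seq (k₁ := 3) (k₂ := vs.length * (14 + 1) + 1) (WP.block hV hs
    (by simp [BlockOk, Instr.Ok]) fun hg => ?_)).mono (by omega) fun _ _ h => h
  refine (WP.while hV (I := I) ?_ ?_ vs.length hg ?_).mono le_rfl ?_
  · rintro j s' hg ⟨pre, rest, rfl, hj, h3, h6, hl, hm, ho⟩
    obtain _ | ⟨u, l⟩ := rest
    · simp at hj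
    have hu := hV u (hvs u (by simp))
    rw [headPtr] at h3
    refine ⟨by omega, WP.block hV hg ?_ ?_⟩
    · simp [BlockOk, Instr.Ok, Instr.exec, BinOp.eval, h3, h6]
      omega
    · have e8 : u + u + (u + u) + (u + u + (u + u)) = 8 * u := by ring
      refine ⟨pre ++ [u], l, by simp, by simpa using hj, ?_, ?_, hl.2, ?_, ?_⟩
      · simp [execBlock, Instr.exec, BinOp.eval, h3, h6, e8, hm, ← hl.1]
      · simp [execBlock, Instr.exec, h6]
      · simp [execBlock, Instr.exec, hm]
      · have : s.mem (8 * u + 3) = if u ∈ M then 1 else 0 := by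
          split_ifs with h
          exacts [(hC.flipped u).1 h, (hC.flipped u).2 h]
        simp [execBlock, Instr.exec, BinOp.eval, h3, h6, e8, hm, ho, hC.color u (by simp), this,
          finalColor]
  · rintro s' - ⟨pre, rest, rfl, hj, h3, -⟩
    obtain rfl := List.length_eq_zero_iff.1 hj
    exact h3
  · refine ⟨[], vs, rfl, rfl, ?_, ?_, hC.linked, ?_, ?_⟩ <;>
      simp [execBlock, Instr.exec, hC.head, ho]
  · rintro s' - ⟨pre, rest, rfl, hj, -, -, -, -, ho⟩
    obtain rfl := List.length_eq_zero_iff.1 hj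
    simpa using ho

end Specs

/-! ### Soundness of the coloring -/

theorem exists_isLast (w c : ℕ → ℕ) {k u : ℕ} {h : List ℕ} (hu : u ∈ h) (hk : c u = k) :
    ∃ v, IsLast w c k h v := by
  obtain ⟨v, hv, hmax⟩ := Finset.exists_max_image (h.toFinset.filter fun v => c v = k)
    (fun v => toLex (w v, v)) ⟨u, by simp [hu, hk]⟩
  simp only [Finset.mem_filter, List.mem_toFinset] at hv
  refine ⟨v, hv.1, hv.2, fun x hx hxk => ?_⟩
  have := hmax x (by simp [hx, hxk])
  rwa [Prod.Lex.toLex_le_toLex] at this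

theorem exists_isFirst (w : ℕ → ℕ) {h : List ℕ} (hne : h ≠ []) : ∃ v, IsFirst w h v := by
  obtain ⟨v, hv, hmin⟩ := Finset.exists_min_image h.toFinset (fun v => toLex (w v, v))
    (by simpa using hne)
  refine ⟨v, by simpa using hv, fun x hx => ?_⟩
  have := hmin x (by simpa using hx)
  rwa [Prod.Lex.toLex_le_toLex] at this

/-- Frozen vertices are not flipped, so a last vertex of color k ends with color 1 - k. If both
colors occur, the two last vertices differ; otherwise the last vertex differs from the flipped first
one. -/
theorem exists_finalColor {w c : ℕ → ℕ} (hc : ∀ u, c u ≤ 1) {F M : Set ℕ} (hFM : Disjoint F M)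
    {h : List ℕ} (hne : h ≠ []) (hF : ∀ k u, IsLast w c k h u → u ∈ F)
    (hM : ∀ u, Mono c h → IsFirst w h u → u ∈ M) :
    (∃ u ∈ h, finalColor c M u = 0) ∧ ∃ u ∈ h, finalColor c M u = 1 := by
  have hnot : ∀ {k u}, IsLast w c k h u → finalColor c M u = 1 - k := by
    intro k u hu
    have h1 : u ∉ M := Set.disjoint_left.1 hFM (hF k u hu)
    have h2 := hu.2.1
    have h3 := hc u
    unfold finalColor
    rw [if_neg h1]
    split_ifs <;> omega
  by_cases hm : Mono c h
  · obtain ⟨v, hv⟩ := exists_isFirst w hne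
    obtain ⟨u, hu⟩ := exists_isLast w c hv.1 rfl
    have hcv : finalColor c M v = c v := by
      have := hc v
      unfold finalColor
      rw [if_pos (hM v hm hv)]
      split_ifs <;> omega
    have hcu := hnot hu
    have := hc v
    obtain h0 | h1 : c v = 0 ∨ c v = 1 := by omega
    · exact ⟨⟨v, hv.1, by omega⟩, ⟨u, hu.1, by omega⟩⟩
    · exact ⟨⟨u, hu.1, by omega⟩, ⟨v, hv.1, by omega⟩⟩
  · unfold Mono at hm
    push Not at hm
    obtain ⟨u, hu, v, hv, huv⟩ := hm
    obtain ⟨x, hx⟩ := exists_isLast w c hu rfl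
    obtain ⟨y, hy⟩ := exists_isLast w c hv rfl
    have h1 := hnot hx
    have h2 := hnot hy
    have h3 := hc u
    have h4 := hc v
    obtain h0 | h0 : c u = 0 ∧ c v = 1 ∨ c u = 1 ∧ c v = 0 := by omega
    · exact ⟨⟨y, hy.1, by omega⟩, ⟨x, hx.1, by omega⟩⟩
    · exact ⟨⟨x, hx.1, by omega⟩, ⟨y, hy.1, by omega⟩⟩

/-! ### Counting bad assignments -/

/-- Independence in counting form: conditions on separate coordinates multiply their proportions. -/
theorem ncard_box_le {Γ : Type*} [Fintype Γ] [Nonempty Γ] (W : Finset ℕ) (P : ℕ → Γ → Prop)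
    (ρ : ℕ → ℝ) (hρ : ∀ v ∈ W, ({y | P v y}.ncard : ℝ) ≤ ρ v * Fintype.card Γ) :
    ({g : W → Γ | ∀ v : W, P v (g v)}.ncard : ℝ) ≤
      (∏ v ∈ W, ρ v) * (Fintype.card Γ : ℝ) ^ W.card := by
  classical
  have h : {g : W → Γ | ∀ v : W, P v (g v)} =
      ↑(Fintype.piFinset fun v : W => Finset.univ.filter fun y => P v y) := by
    ext g
    simp
  have h1 : ∀ v, {y | P v y}.ncard = (Finset.univ.filter fun y => P v y).card := fun v => by
    rw [← Set.ncard_coe_finset]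
    simp
  simp only [h1] at hρ
  rw [h, Set.ncard_coe_finset, Fintype.card_piFinset, Nat.cast_prod,
    Finset.prod_coe_sort W fun v => ((Finset.univ.filter fun y => P v y).card : ℝ)]
  refine (Finset.prod_le_prod (fun _ _ => Nat.cast_nonneg _) hρ).trans ?_
  rw [Finset.prod_mul_distrib, Finset.prod_const]

section Counting

variable {N : ℕ}

theorem ncard_le_of_color (k : Bool) (A : Finset ℕ) (Q : Fin N × Bool → Prop)
    (hQ : ∀ y, Q y → y.2 = k ∧ (y.1 : ℕ) ∈ A) : {y | Q y}.ncard ≤ A.card := by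
  rw [← Set.ncard_coe_finset]
  refine Set.ncard_le_ncard_of_injOn (fun y => (y.1 : ℕ)) (fun y hy => (hQ y hy).2) ?_
  rintro ⟨a, b⟩ hy ⟨a', b'⟩ hy' h
  exact Prod.ext (Fin.ext h) ((hQ _ hy).1.trans (hQ _ hy').1.symm)

theorem ncard_color_le (k : Bool) (j : ℕ) (hj : j ≤ N) :
    ({y : Fin N × Bool | y.2 = k ∧ j ≤ y.1}.ncard : ℝ) ≤ N - j := by
  have := ncard_le_of_color k (Finset.Ico j N) (fun y : Fin N × Bool => y.2 = k ∧ j ≤ y.1)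
    fun y hy => ⟨hy.1, by simp [hy.2]⟩
  rw [Nat.card_Ico] at this
  rw [← Nat.cast_sub hj]
  exact_mod_cast this

/-- The other color leaves all N weights free, and color k leaves the j + 1 weights 0, ..., j. -/
theorem ncard_color_imp_le (k : Bool) (j : ℕ) :
    ({y : Fin N × Bool | y.2 = k → (y.1 : ℕ) ≤ j}.ncard : ℝ) ≤ N + (j + 1) := by
  have h1 := ncard_le_of_color (!k) (Finset.range N) (fun y : Fin N × Bool => y.2 = !k)
    fun y hy => ⟨hy, by simp⟩
  have h2 := ncard_le_of_color k (Finset.range (j + 1))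
    (fun y : Fin N × Bool => y.2 = k ∧ (y.1 : ℕ) ≤ j)
    fun y hy => ⟨hy.1, by simp only [Finset.mem_range]; omega⟩
  have h3 : {y : Fin N × Bool | y.2 = k → (y.1 : ℕ) ≤ j} ⊆
      {y : Fin N × Bool | y.2 = !k} ∪ {y : Fin N × Bool | y.2 = k ∧ (y.1 : ℕ) ≤ j} := by
    intro y
    simp only [Set.mem_ofPred_eq, Set.mem_union]
    cases y.2 <;> cases k <;> simp
  have h4 := (Set.ncard_le_ncard h3 (Set.toFinite _)).trans (Set.ncard_union_le _ _)
  rw [Finset.card_range] at h1 h2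
  exact_mod_cast h4.trans (add_le_add h1 h2)

/-- The assignments for which all vertices of `e` have color `k` and weight at least `T`. -/
theorem ncard_heavy_le (hN : 0 < N) (W e : Finset ℕ) (he : e ⊆ W) (k : Bool) (T : ℕ) (hT : T ≤ N) :
    ({g : W → Fin N × Bool |
      ∀ v : W, ↑v ∈ e → (g v).2 = k ∧ T ≤ (g v).1}.ncard : ℝ) ≤
      ((N - T : ℝ) / (2 * N)) ^ e.card * (2 * N : ℝ) ^ W.card := by
  have : NeZero N := ⟨hN.ne'⟩
  have hN' : (0 : ℝ) < N := by exact_mod_cast hN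
  have hcard : (Fintype.card (Fin N × Bool) : ℝ) = 2 * N := by
    simp [mul_comm]
  have := ncard_box_le W (fun v (y : Fin N × Bool) => v ∈ e → y.2 = k ∧ T ≤ y.1)
    (fun v => if v ∈ e then (N - T : ℝ) / (2 * N) else 1) ?_
  · rw [hcard, Finset.prod_ite_mem, Finset.prod_const, Finset.inter_eq_right.2 he] at this
    exact this
  · intro v _
    rw [hcard]
    split_ifs with hv
    · rw [div_mul_cancel₀ _ (by positivity)]
      simpa [hv] using ncard_color_le k T hT
    · simp [hv]
      rw [mul_comm]

/-- The assignments for which `e` and `f` meet in a single vertex, of color `k` and weight `j`,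
which is a first vertex of the monochromatic edge `e` and a last vertex of its color in `f`. -/
theorem ncard_conflict_le {n : ℕ} (hn : 1 ≤ n) (hnN : n ≤ N) (W e f : Finset ℕ) (he : e ⊆ W)
    (hf : f ⊆ W) (hen : e.card = n) (hfn : f.card = n) (k : Bool) (j : ℕ) (hj : j < N) :
    ({g : W → Fin N × Bool | ∃ u : W, e ∩ f = {↑u} ∧
      g u = (⟨j, hj⟩, k) ∧ (∀ v : W, ↑v ∈ e → (g v).2 = k ∧ j ≤ (g v).1) ∧
      ∀ v : W, ↑v ∈ f → (g v).2 = k → ((g v).1 : ℕ) ≤ j}.ncard : ℝ) ≤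
      6 / (N * 4 ^ n) * (2 * N : ℝ) ^ W.card := by
  have hN : 0 < N := by omega
  have : NeZero N := ⟨hN.ne'⟩
  have hN' : (0 : ℝ) < N := by exact_mod_cast hN
  have hcard : (Fintype.card (Fin N × Bool) : ℝ) = 2 * N := by
    simp [mul_comm]
  by_cases hu : ∃ u : W, e ∩ f = {↑u}
  swap
  · refine le_trans (b := ((∅ : Set (W → Fin N × Bool)).ncard : ℝ)) ?_ (by simp; positivity)
    exact Nat.cast_le.2
      (Set.ncard_le_ncard (fun g ⟨u, h1, _⟩ => (hu ⟨u, h1⟩).elim) (Set.toFinite _))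
  obtain ⟨u, huef⟩ := hu
  have hue : ↑u ∈ e := Finset.mem_of_mem_inter_left (huef ▸ Finset.mem_singleton_self _)
  have huf : ↑u ∈ f := Finset.mem_of_mem_inter_right (huef ▸ Finset.mem_singleton_self _)
  have huv : ∀ v, v ∈ e → v ∈ f → v = ↑u := fun v h1 h2 => by
    simpa [huef] using Finset.mem_inter.2 ⟨h1, h2⟩
  -- Since e and f meet only in u, each vertex is subject to at most one of the three conditions, so
  -- the event lies in a box.
  let P : ℕ → Fin N × Bool → Prop := fun v y => (v = ↑u → y = (⟨j, hj⟩, k)) ∧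
    (v ∈ e.erase u → y.2 = k ∧ j ≤ y.1) ∧ (v ∈ f.erase u → y.2 = k → (y.1 : ℕ) ≤ j)
  have key := ncard_box_le W P (fun v => (if v ∈ ({↑u} : Finset ℕ) then 1 / (2 * N : ℝ) else 1) *
    (if v ∈ e.erase u then (N - j : ℝ) / (2 * N) else 1) *
    (if v ∈ f.erase u then (N + (j + 1) : ℝ) / (2 * N) else 1)) ?_
  · have hsub : {g : W → Fin N × Bool | ∃ u : W, e ∩ f = {↑u} ∧
      g u = (⟨j, hj⟩, k) ∧ (∀ v : W, ↑v ∈ e → (g v).2 = k ∧ j ≤ (g v).1) ∧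
      ∀ v : W, ↑v ∈ f → (g v).2 = k → ((g v).1 : ℕ) ≤ j} ⊆
        {g : W → Fin N × Bool | ∀ v : W, P v (g v)} := by
      rintro g ⟨u', hu', h1, h2, h3⟩ v
      obtain rfl : u' = u := by
        rw [huef, Finset.singleton_inj] at hu'
        exact Subtype.ext hu'.symm
      refine ⟨fun hv => ?_, fun hv => h2 v (Finset.mem_of_mem_erase hv),
        fun hv => h3 v (Finset.mem_of_mem_erase hv)⟩
      rw [Subtype.ext hv, h1]
    refine (Nat.cast_le.2 (Set.ncard_le_ncard hsub (Set.toFinite _))).trans (key.trans ?_)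
    rw [hcard]
    refine mul_le_mul_of_nonneg_right ?_ (by positivity)
    rw [Finset.prod_mul_distrib, Finset.prod_mul_distrib, Finset.prod_ite_mem,
      Finset.prod_ite_mem, Finset.prod_ite_mem, Finset.prod_const, Finset.prod_const,
      Finset.prod_const, Finset.inter_eq_right.2 (Finset.singleton_subset_iff.2 u.2),
      Finset.inter_eq_right.2 ((Finset.erase_subset _ _).trans he),
      Finset.inter_eq_right.2 ((Finset.erase_subset _ _).trans hf), Finset.card_singleton,
      Finset.card_erase_of_mem hue, Finset.card_erase_of_mem huf, hen, hfn, pow_one, mul_assoc,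
      ← mul_pow]
    have hjN : (j : ℝ) ≤ N := by exact_mod_cast hj.le
    -- Here (N - j)(N + j + 1) = N² + N - j² - j ≤ N² + N: the linear terms in j of size jN cancel,
    -- and the bound is uniform in j.
    have h1 : (N - j : ℝ) / (2 * N) * ((N + (j + 1)) / (2 * N)) ≤ (1 + 1 / N) / 4 := by
      rw [div_mul_div_comm, div_le_div_iff₀ (by positivity) (by norm_num)]
      have : (1 + 1 / N : ℝ) * (2 * N * (2 * N)) = 4 * (N * N + N) := by
        field_simp
        ring
      rw [this]
      nlinarith [mul_nonneg (Nat.cast_nonneg (α := ℝ) j) (Nat.cast_nonneg (α := ℝ) j)]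
    have h0 : 0 ≤ (N - j : ℝ) / (2 * N) * ((N + (j + 1)) / (2 * N)) :=
      mul_nonneg (div_nonneg (by linarith) (by positivity)) (by positivity)
    -- As n ≤ N, allowing ties among N discrete weights costs at most a factor e.
    have h2 : (1 + 1 / N : ℝ) ^ (n - 1) ≤ 3 := by
      calc (1 + 1 / N : ℝ) ^ (n - 1) ≤ Real.exp (1 / N) ^ (n - 1) := by
            gcongr
            rw [add_comm]
            exact Real.add_one_le_exp _
        _ = Real.exp ((n - 1 : ℕ) * (1 / N)) := (Real.exp_nat_mul _ _).symm
        _ ≤ Real.exp 1 := by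
            refine Real.exp_le_exp.2 ?_
            rw [mul_one_div, div_le_one hN']
            exact_mod_cast (Nat.sub_le _ _).trans hnN
        _ ≤ 3 := by linarith [Real.exp_one_lt_d9]
    have h4 : (4 : ℝ) ^ n = 4 ^ (n - 1) * 4 := by
      rw [← pow_succ, Nat.sub_add_cancel hn]
    calc 1 / (2 * N : ℝ) * ((N - j : ℝ) / (2 * N) * ((N + (j + 1)) / (2 * N))) ^ (n - 1)
        ≤ 1 / (2 * N : ℝ) * ((1 + 1 / N) / 4) ^ (n - 1) := by gcongr
      _ = 1 / (2 * N : ℝ) * ((1 + 1 / N) ^ (n - 1) / 4 ^ (n - 1)) := by rw [div_pow]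
      _ ≤ 1 / (2 * N : ℝ) * (3 / 4 ^ (n - 1)) := by gcongr
      _ = 6 / (N * 4 ^ n) := by
          rw [h4]
          field_simp
          norm_num
  · intro v _
    rw [hcard]
    have hjN : (j : ℝ) ≤ N := by exact_mod_cast hj.le
    by_cases h1 : v = ↑u
    · subst h1
      have : {y | P (↑u) y} ⊆ {(⟨j, hj⟩, k)} := fun y h => h.1 rfl
      have := Set.ncard_le_ncard this (Set.toFinite _)
      rw [Set.ncard_singleton] at this
      simp only [Finset.mem_singleton, if_true, Finset.mem_erase, ne_eq, not_true_eq_false,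
        false_and, if_false, mul_one]
      rw [div_mul_cancel₀ _ (by positivity)]
      exact_mod_cast this
    · by_cases h2 : v ∈ e
      · have h3 : v ∉ f := fun h3 => h1 (huv v h2 h3)
        simp only [P, Finset.mem_singleton, Finset.mem_erase, h1, h2, h3, ne_eq, if_false, if_true,
          not_false_eq_true, and_false, and_true, false_imp_iff, true_and, true_imp_iff, one_mul,
          mul_one]
        rw [div_mul_cancel₀ _ (by positivity)]
        exact ncard_color_le k j hj.le
      · by_cases h3 : v ∈ f
        · simp only [P, Finset.mem_singleton, Finset.mem_erase, h1, h2, h3, ne_eq, if_false,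
            if_true, not_false_eq_true, and_false, and_true, false_imp_iff, true_and,
            true_imp_iff, one_mul]
          rw [div_mul_cancel₀ _ (by positivity)]
          exact ncard_color_imp_le k j
        · simp [P, h1, h2, h3]
          rw [mul_comm]

end Counting

/-! ### Choice of the weight threshold and the union bound -/

theorem one_sub_pow_le {x y : ℝ} (h0 : 0 ≤ 1 - x) (hxy : y ≤ x) (n : ℕ) :
    (1 - x) ^ n ≤ Real.exp (-(n * y)) := by
  calc (1 - x) ^ n ≤ Real.exp (-x) ^ n := by
        gcongr
        linarith [Real.add_one_le_exp (-x)]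
    _ = Real.exp (n * -x) := (Real.exp_nat_mul _ _).symm
    _ ≤ Real.exp (-(n * y)) := by
        refine Real.exp_le_exp.2 ?_
        rw [mul_neg, neg_le_neg_iff]
        gcongr

theorem four_le_log {n : ℕ} (hn : 100 ≤ n) : 4 ≤ Real.log n := by
  have hn' : (100 : ℝ) ≤ n := by exact_mod_cast hn
  rw [Real.le_log_iff_exp_le (by linarith)]
  calc Real.exp 4 = Real.exp 1 ^ 4 := by rw [← Real.exp_nat_mul]; norm_num
    _ ≤ 3 ^ 4 := by
        gcongr
        linarith [Real.exp_one_lt_d9]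
    _ ≤ n := by linarith

/-- For T = ⌈N ln n / (2n)⌉ the factor (1 - T/N)^n ≤ 1/√n cancels the √n in K, and the first term is
at most 1/(5√(ln n)) ≤ 1/10. The second is at most 12/100 · (1/2 + 1/ln n) ≤ 9/100. Both use ln n ≥
4, which follows from n ≥ 100. -/
theorem exists_threshold {n N : ℕ} (hn : 100 ≤ n) (hnN : n ≤ N) {K : ℝ} (hK0 : 0 ≤ K)
    (hK : K ≤ 1 / 10 * Real.sqrt (n / Real.log n) * 2 ^ n) :
    ∃ T : ℕ, T ≤ N ∧ 2 * K * ((N - T : ℝ) / (2 * N)) ^ n + 2 * K ^ 2 * T * (6 / (N * 4 ^ n)) ≤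
      1 / 4 := by
  have hn' : (100 : ℝ) ≤ n := by exact_mod_cast hn
  have hnN' : (n : ℝ) ≤ N := by exact_mod_cast hnN
  have hN : (0 : ℝ) < N := by linarith
  set L := Real.log n with hL
  have hL4 : 4 ≤ L := four_le_log hn
  have hLn : L ≤ n := (Real.log_le_sub_one_of_pos (by linarith)).trans (by linarith)
  have hTN : ⌈N * (L / (2 * n))⌉₊ ≤ N := by
    refine Nat.ceil_le.2 (mul_le_of_le_one_right hN.le ?_)
    rw [div_le_one (by positivity)]
    linarith
  refine ⟨⌈N * (L / (2 * n))⌉₊, hTN, ?_⟩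
  set T := ⌈N * (L / (2 * n))⌉₊ with hT
  have hTN' : (T : ℝ) ≤ N := by exact_mod_cast hTN
  have hT1 : L / (2 * n) ≤ T / N := by
    rw [le_div_iff₀ hN, mul_comm]
    exact Nat.le_ceil _
  -- Rounding T up adds at most 1/N ≤ 1/n.
  have hT2 : (T : ℝ) / N ≤ L / (2 * n) + 1 / n := by
    rw [div_le_iff₀ hN]
    have h1 := (Nat.ceil_lt_add_one (a := N * (L / (2 * n))) (by positivity)).le
    have h2 : 1 ≤ 1 / (n : ℝ) * N := by
      rw [one_div_mul_eq_div, one_le_div (by linarith)]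
      exact hnN'
    linarith
  have hsq : Real.exp (-(n * (L / (2 * n)))) = 1 / Real.sqrt n := by
    have : n * (L / (2 * n)) = 1 / 2 * L := by field_simp
    rw [this, Real.exp_neg, Real.sqrt_eq_rpow, Real.rpow_def_of_pos (by linarith), ← hL,
      one_div (Real.exp _), mul_comm]
  have first : 2 * K * ((N - T : ℝ) / (2 * N)) ^ n ≤ 1 / 10 := by
    have e1 : ((N - T : ℝ) / (2 * N)) ^ n = (1 - T / N) ^ n / 2 ^ n := by
      rw [← div_pow]
      congr 1
      field_simp
    have h0 : 0 ≤ 1 - (T : ℝ) / N := by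
      rw [sub_nonneg, div_le_one hN]
      exact hTN'
    have e2 := one_sub_pow_le h0 hT1 n
    rw [hsq] at e2
    rw [e1]
    calc 2 * K * ((1 - T / N) ^ n / 2 ^ n)
        ≤ 2 * (1 / 10 * Real.sqrt (n / L) * 2 ^ n) * (1 / Real.sqrt n / 2 ^ n) := by gcongr
      _ = 1 / 5 * (1 / Real.sqrt L) := by
          rw [Real.sqrt_div (by linarith)]
          have : Real.sqrt n ≠ 0 := (Real.sqrt_pos.2 (by linarith)).ne'
          have : Real.sqrt L ≠ 0 := (Real.sqrt_pos.2 (by linarith)).ne'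
          field_simp
          norm_num
      _ ≤ 1 / 5 * (1 / 2) := by
          have : 2 ≤ Real.sqrt L := Real.le_sqrt_of_sq_le (by linarith)
          gcongr
      _ = 1 / 10 := by norm_num
  have second : 2 * K ^ 2 * T * (6 / (N * 4 ^ n)) ≤ 9 / 100 := by
    have hK2 : K ^ 2 ≤ 1 / 100 * (n / L) * 4 ^ n := by
      calc K ^ 2 ≤ (1 / 10 * Real.sqrt (n / L) * 2 ^ n) ^ 2 := by gcongr
        _ = 1 / 100 * (n / L) * 4 ^ n := by
            rw [mul_pow, mul_pow, Real.sq_sqrt (by positivity), ← pow_mul, mul_comm n 2, pow_mul]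
            norm_num
    calc 2 * K ^ 2 * T * (6 / (N * 4 ^ n)) = 12 * K ^ 2 * (T / N) / 4 ^ n := by
          field_simp
          ring
      _ ≤ 12 * (1 / 100 * (n / L) * 4 ^ n) * (L / (2 * n) + 1 / n) / 4 ^ n := by gcongr
      _ = 12 / 100 * (1 / 2 + 1 / L) := by
          field_simp
      _ ≤ 12 / 100 * (1 / 2 + 1 / 4) := by gcongr
      _ = 9 / 100 := by norm_num
  linarith

/-- The assignments of weights and colors for which some vertex is both the first vertex of a
monochromatic edge and the last one of its color in some edge. -/
def badAssignments (N : ℕ) (W : Finset ℕ) (E : Finset (Finset ℕ)) : Set (W → Fin N × Bool) :=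
  {g | ∃ e ∈ E, ∃ f ∈ E, ∃ u : W, e ∩ f = {↑u} ∧
    (∀ v : W, ↑v ∈ e → (g v).2 = (g u).2 ∧ (g u).1 ≤ (g v).1) ∧
    ∀ v : W, ↑v ∈ f → (g v).2 = (g u).2 → (g v).1 ≤ (g u).1}

/-- If the conflicting vertex weighs at least T, so does all of e, and f is forgotten: 2|E| events.
Otherwise the pair, the color and the weight are fixed: at most 2|E|²T events. -/
theorem ncard_badAssignments_le {n N : ℕ} (hn : 100 ≤ n) (hnN : n ≤ N) (W : Finset ℕ)
    (E : Finset (Finset ℕ)) (hE : ∀ e ∈ E, e ⊆ W ∧ e.card = n)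
    (hK : (E.card : ℝ) ≤ 1 / 10 * Real.sqrt (n / Real.log n) * 2 ^ n) :
    ((badAssignments N W E).ncard : ℝ) ≤ 1 / 4 * (2 * N : ℝ) ^ W.card := by
  obtain ⟨T, hTN, hT⟩ := exists_threshold hn hnN (Nat.cast_nonneg E.card) hK
  let A : Finset ℕ × Bool → Set (W → Fin N × Bool) := fun p =>
    {g | ∀ v : W, ↑v ∈ p.1 → (g v).2 = p.2 ∧ T ≤ (g v).1}
  let C : (Finset ℕ × Finset ℕ) × Bool × Fin N → Set (W → Fin N × Bool) := fun p =>
    {g | ∃ u : W, p.1.1 ∩ p.1.2 = {↑u} ∧ g u = (p.2.2, p.2.1) ∧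
      (∀ v : W, ↑v ∈ p.1.1 → (g v).2 = p.2.1 ∧ (p.2.2 : ℕ) ≤ (g v).1) ∧
      ∀ v : W, ↑v ∈ p.1.2 → (g v).2 = p.2.1 → ((g v).1 : ℕ) ≤ p.2.2}
  let IA := E ×ˢ (Finset.univ : Finset Bool)
  let IC := (E ×ˢ E) ×ˢ (Finset.univ : Finset Bool) ×ˢ
    (Finset.univ.filter fun j : Fin N => (j : ℕ) < T)
  have hsub : badAssignments N W E ⊆ (⋃ p ∈ IA, A p) ∪ ⋃ p ∈ IC, C p := by
    rintro g ⟨e, he, f, hf, u, huef, h1, h2⟩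
    by_cases hTu : T ≤ (g u).1
    · left
      refine Set.mem_biUnion (x := (e, (g u).2)) (by simp [IA, he]) fun v hv => ⟨(h1 v hv).1, ?_⟩
      exact hTu.trans (h1 v hv).2
    · right
      refine Set.mem_biUnion (x := ((e, f), (g u).2, (g u).1)) ?_ ⟨u, huef, rfl, h1, h2⟩
      simpa [IC, he, hf] using hTu
  have hA : ∀ p ∈ IA, ((A p).ncard : ℝ) ≤
      ((N - T : ℝ) / (2 * N)) ^ n * (2 * N : ℝ) ^ W.card := by
    rintro ⟨e, k⟩ hp
    have he : e ∈ E := by simpa [IA] using hp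
    rw [← (hE e he).2]
    exact ncard_heavy_le (by omega) W e (hE e he).1 k T hTN
  have hC : ∀ p ∈ IC, ((C p).ncard : ℝ) ≤ 6 / (N * 4 ^ n) * (2 * N : ℝ) ^ W.card := by
    rintro ⟨⟨e, f⟩, k, j⟩ hp
    simp only [IC, Finset.mem_product, Finset.mem_univ, true_and] at hp
    exact ncard_conflict_le (by omega) hnN W e f (hE e hp.1.1).1 (hE f hp.1.2).1 (hE e hp.1.1).2
      (hE f hp.1.2).2 k j j.2
  have hIA : (IA.card : ℝ) = 2 * E.card := by
    simp [IA, Finset.card_product, mul_comm]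
  have hIC : (IC.card : ℝ) ≤ 2 * E.card ^ 2 * T := by
    have : (Finset.univ.filter fun j : Fin N => (j : ℕ) < T).card ≤ T := by
      rw [← Finset.card_range T]
      exact Finset.card_le_card_of_injOn (fun j => (j : ℕ)) (fun j hj => by simpa using hj)
        fun a _ b _ h => Fin.ext h
    have h2 : IC.card ≤ E.card * E.card * (2 * T) := by
      simp only [IC, Finset.card_product, Finset.card_univ, Fintype.card_bool]
      gcongr
    calc (IC.card : ℝ) ≤ E.card * E.card * (2 * T) := by exact_mod_cast h2
      _ = _ := by ring
  have hN : (0 : ℝ) < N := by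
    have : 0 < N := by omega
    exact_mod_cast this
  calc ((badAssignments N W E).ncard : ℝ)
      ≤ ((⋃ p ∈ IA, A p) ∪ ⋃ p ∈ IC, C p).ncard :=
        Nat.cast_le.2 (Set.ncard_le_ncard hsub (Set.toFinite _))
    _ ≤ (∑ p ∈ IA, (A p).ncard : ℕ) + (∑ p ∈ IC, (C p).ncard : ℕ) := by
        exact_mod_cast (Set.ncard_union_le _ _).trans
          (add_le_add (Finset.set_ncard_biUnion_le _ _) (Finset.set_ncard_biUnion_le _ _))
    _ ≤ IA.card * (((N - T : ℝ) / (2 * N)) ^ n * (2 * N : ℝ) ^ W.card) +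
        IC.card * (6 / (N * 4 ^ n) * (2 * N : ℝ) ^ W.card) := by
        push_cast
        refine add_le_add ?_ ?_
        · simpa using Finset.sum_le_card_nsmul IA (fun p => ((A p).ncard : ℝ)) _ hA
        · simpa using Finset.sum_le_card_nsmul IC (fun p => ((C p).ncard : ℝ)) _ hC
    _ ≤ 2 * E.card * (((N - T : ℝ) / (2 * N)) ^ n * (2 * N : ℝ) ^ W.card) +
        2 * E.card ^ 2 * T * (6 / (N * 4 ^ n) * (2 * N : ℝ) ^ W.card) := by
        rw [hIA]
        gcongr
    _ = (2 * E.card * ((N - T : ℝ) / (2 * N)) ^ n + 2 * E.card ^ 2 * T * (6 / (N * 4 ^ n))) *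
          (2 * N : ℝ) ^ W.card := by ring
    _ ≤ 1 / 4 * (2 * N : ℝ) ^ W.card := by gcongr

/-! ### The probability of failure -/

theorem bitsVal_injective {ω ω' : ℕ → Bool} {p d : ℕ} (h : bitsVal ω p d = bitsVal ω' p d) :
    ∀ i < d, ω (p + i) = ω' (p + i) := by
  induction d with
  | zero => simp
  | succ d ih =>
    rw [bitsVal, bitsVal] at h
    have h1 := Bool.toNat_le (ω (p + d))
    have h2 := Bool.toNat_le (ω' (p + d))
    intro i hi
    obtain rfl | hi' : i = d ∨ i < d := by omega
    · revert h h1 h2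
      cases ω (p + i) <;> cases ω' (p + i) <;> simp <;> omega
    · exact ih (by omega) i hi'

instance : MeasureTheory.IsProbabilityMeasure fairBits := by
  unfold fairBits
  infer_instance

theorem fairBits_cylinder (ω₀ : ℕ → Bool) (m : ℕ) :
    fairBits {ω | ∀ i < m, ω i = ω₀ i} = (2⁻¹ : ENNReal) ^ m := by
  have h : {ω : ℕ → Bool | ∀ i < m, ω i = ω₀ i} =
      Set.pi (Finset.range m : Set ℕ) fun i => {ω₀ i} := by
    ext ω
    simp [Set.mem_pi]
  rw [h, fairBits, MeasureTheory.Measure.infinitePi_pi _ fun _ _ => measurableSet_singleton _]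
  simp

/-- The weight (less `2 ^ d`) and the color that are drawn for the vertices in `W`, if those are
discovered in the order given by `idx`. -/
def assignment (d : ℕ) (idx : ℕ → ℕ) (W : Finset ℕ) (ω : ℕ → Bool) : W → Fin (2 ^ d) × Bool :=
  fun v => (⟨bitsVal ω (idx v * (d + 1)) d - 2 ^ d, by
    have := bitsVal_lt ω (idx v * (d + 1)) d
    have := le_bitsVal ω (idx v * (d + 1)) d
    omega⟩, ω (idx v * (d + 1) + d))

/-- The vertices of W fill all positions below |W|, so an assignment determines the first |W|(d + 1)
bits and its fiber lies in a cylinder. Upper bounds suffice, so no measurability enters. -/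
theorem fairBits_assignment_le (d : ℕ) (idx : ℕ → ℕ) (W : Finset ℕ)
    (hidx : ∀ i < W.card, ∃ v ∈ W, idx v = i) (G : Set (W → Fin (2 ^ d) × Bool))
    (hG : (G.ncard : ℝ) ≤ 1 / 4 * (2 * (2 ^ d : ℕ) : ℝ) ^ W.card) :
    fairBits {ω | assignment d idx W ω ∈ G} ≤ 1 / 4 := by
  classical
  have fiber : ∀ g, fairBits {ω | assignment d idx W ω = g} ≤
      (2⁻¹ : ENNReal) ^ (W.card * (d + 1)) := by
    intro g
    by_cases hg : ∃ ω₀, assignment d idx W ω₀ = g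
    · obtain ⟨ω₀, rfl⟩ := hg
      rw [← fairBits_cylinder ω₀]
      refine MeasureTheory.measure_mono fun ω hω i hi => ?_
      have hdiv : i / (d + 1) < W.card := Nat.div_lt_of_lt_mul (by rwa [mul_comm])
      obtain ⟨v, hv, hvi⟩ := hidx _ hdiv
      have hmod : i % (d + 1) < d + 1 := Nat.mod_lt i (by omega)
      have hi' : idx v * (d + 1) + i % (d + 1) = i := by
        rw [hvi, mul_comm]
        exact Nat.div_add_mod _ _
      have h := congrFun hω ⟨v, hv⟩
      simp only [assignment, Prod.mk.injEq, Fin.mk.injEq] at h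
      rw [← hi']
      obtain h' | h' : i % (d + 1) = d ∨ i % (d + 1) < d := by omega
      · rw [h']
        exact h.2
      · refine bitsVal_injective ?_ _ h'
        have := le_bitsVal ω (idx v * (d + 1)) d
        have := le_bitsVal ω₀ (idx v * (d + 1)) d
        omega
    · have : {ω | assignment d idx W ω = g} = ∅ :=
        Set.eq_empty_of_forall_notMem fun ω hω => hg ⟨ω, hω⟩
      simp [this]
  have hcover : {ω | assignment d idx W ω ∈ G} =
      ⋃ g ∈ G.toFinset, {ω | assignment d idx W ω = g} := by
    ext ω
    simp
  rw [hcover]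
  refine (MeasureTheory.measure_biUnion_finset_le _ _).trans
    ((Finset.sum_le_sum fun g _ => fiber g).trans ?_)
  rw [Finset.sum_const, ← Set.ncard_eq_toFinset_card', nsmul_eq_mul]
  have h4 : 4 * G.ncard ≤ 2 ^ (W.card * (d + 1)) := by
    have e : (2 * (2 ^ d : ℕ) : ℝ) ^ W.card = 2 ^ (W.card * (d + 1)) := by
      push_cast
      rw [← pow_succ', ← pow_mul, mul_comm]
    rw [e] at hG
    have : (4 * G.ncard : ℝ) ≤ 2 ^ (W.card * (d + 1)) := by linarith
    exact_mod_cast this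
  rw [← ENNReal.inv_pow, ← div_eq_mul_inv, ENNReal.div_le_iff (by positivity) (by finiteness),
    mul_comm, mul_one_div, ENNReal.le_div_iff_mul_le (by simp) (by simp), mul_comm]
  exact_mod_cast h4

/-! ### The run of the algorithm -/

/-- The vertices that occur in the stream, the latest one first. -/
def vertices (S : List (List ℕ)) : List ℕ := discover [] S.flatten

/-- The position of a vertex in the order of discovery. -/
def position (S : List (List ℕ)) (u : ℕ) : ℕ := (vertices S).reverse.idxOf u

/-- The random weight of a vertex. -/
def weight (n : ℕ) (S : List (List ℕ)) (ω : ℕ → Bool) (u : ℕ) : ℕ :=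
  bitsVal ω (position S u * (Nat.clog 2 n + 1)) (Nat.clog 2 n)

/-- The random color of a vertex. -/
def color (n : ℕ) (S : List (List ℕ)) (ω : ℕ → Bool) (u : ℕ) : ℕ :=
  (ω (position S u * (Nat.clog 2 n + 1) + Nat.clog 2 n)).toNat

/-- The vertices that get frozen. -/
def frozenSet (n : ℕ) (S : List (List ℕ)) (ω : ℕ → Bool) : Set ℕ :=
  {u | ∃ h ∈ S, ∃ k, IsLast (weight n S ω) (color n S ω) k h u}

/-- The vertices that get flipped. -/
def flippedSet (n : ℕ) (S : List (List ℕ)) (ω : ℕ → Bool) : Set ℕ :=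
  {u | ∃ h ∈ S, Mono (color n S ω) h ∧ IsFirst (weight n S ω) h u}

theorem nodup_vertices (S : List (List ℕ)) : (vertices S).Nodup := nodup_discover _ List.nodup_nil

/-- The list has the latest vertex first, so the position of u in the reversed list is the number of
entries behind u. -/
theorem drawn_vertices (n : ℕ) (S : List (List ℕ)) (ω : ℕ → Bool) :
    Drawn n ω (weight n S ω) (color n S ω) (vertices S) := by
  rintro u l ⟨t, ht⟩
  have hu : u ∉ l := by
    have := nodup_vertices S
    rw [← ht] at this
    exact (List.nodup_cons.1 this.of_append_right).1
  have : position S u = l.length := by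
    rw [position, ← ht, List.reverse_append, List.reverse_cons, List.append_assoc,
      List.idxOf_append_of_notMem (by simpa using hu)]
    simp
  rw [weight, color, this]
  exact ⟨rfl, rfl⟩

theorem weight_pos (n : ℕ) (S : List (List ℕ)) (ω : ℕ → Bool) (u : ℕ) : 0 < weight n S ω u :=
  (Nat.two_pow_pos _).trans_le (le_bitsVal _ _ _)

theorem weight_lt {n : ℕ} (hn : 2 ≤ n) (S : List (List ℕ)) (ω : ℕ → Bool) (u : ℕ) :
    weight n S ω u < 4 * n := by
  have h1 := bitsVal_lt ω (position S u * (Nat.clog 2 n + 1)) (Nat.clog 2 n)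
  have h2 := Nat.pow_pred_clog_lt_self (b := 2) (by norm_num) (x := n) (by omega)
  have h3 : 0 < Nat.clog 2 n := Nat.clog_pos (by norm_num) (by omega)
  have h4 : 2 ^ Nat.clog 2 n = 2 * 2 ^ (Nat.clog 2 n).pred := by
    rw [← pow_succ', Nat.pred_eq_sub_one, Nat.sub_add_cancel h3]
  unfold weight
  omega

theorem color_le_one (n : ℕ) (S : List (List ℕ)) (ω : ℕ → Bool) (u : ℕ) : color n S ω u ≤ 1 :=
  Bool.toNat_le _

theorem good_initState {V : Finset ℕ} {n B : ℕ} (hnB : n ≤ 2 ^ B) : Good V B (initState n B) := by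
  have e : 2 ^ (B + 4) = 16 * 2 ^ B := by ring
  have h1 : B < 2 ^ B := Nat.lt_two_pow_self
  refine ⟨fun x => ?_, fun x hx => ?_, fun a => ?_, fun a ha => absurd rfl ha⟩
  · simp only [initState, Finsupp.coe_update, Function.update_apply, Finsupp.single_apply]
    split_ifs <;> omega
  · simp only [initState, Finsupp.coe_update, Function.update_apply, Finsupp.single_apply]
    rw [if_neg (by omega), if_neg (by omega)]
  · simp [initState]

theorem core_initState (n B : ℕ) (w c : ℕ → ℕ) : Core n w c [] ∅ ∅ (initState n B) := by
  constructor <;> simp [initState, headPtr, Linked]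

theorem exists_run {V : Finset ℕ} {n B : ℕ} {S : List (List ℕ)} (hV : ∀ u ∈ V, u < 2 ^ B)
    (hn : 2 ≤ n) (hnB : n ≤ 2 ^ B) (hS : ∀ h ∈ S, h.length = n ∧ ∀ u ∈ h, u ∈ V)
    (ω : ℕ → Bool) :
    ∃ r, alg.Run n B ω S r ∧ r.space ≤ spaceBound V B ∧
      r.updateTime ≤ (n * (7 * Nat.clog 2 n + 54) + 58) * (2 * B + 9) ∧
      r.reportTime ≤ ((vertices S).length * 15 + 4) * (2 * B + 9) ∧
      r.coloring = (vertices S).map (fun u => (u, finalColor (color n S ω) (flippedSet n S ω) u)) ∧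
      (r.failed = false ↔ Disjoint (frozenSet n S ω) (flippedSet n S ω)) := by
  obtain ⟨s, t, m, hp, ht, hm, hg, hC⟩ := pass_spec hV (by omega) hnB (weight_pos n S ω)
    (weight_lt hn S ω) (color_le_one n S ω) S hS (good_initState hnB) (drawn_vertices n S ω)
    (core_initState n B _ _)
  rw [Set.empty_union, Set.empty_union] at hC
  have hvs : ∀ u ∈ discover [] S.flatten, u ∈ V := by
    intro u hu
    rw [mem_discover, List.mem_flatten] at hu
    obtain hu | ⟨h, hh, hu⟩ := hu
    · simp at hu
    · exact (hS h hh).2 u hu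
  obtain ⟨s', t', m', he, ht', hm', -, hout⟩ := report_spec (ω := ω)
    (s := { s with input := [], out := [] }) hV (hg.congr rfl rfl) hvs
    (hC.congr rfl rfl rfl rfl rfl) rfl
  exact ⟨⟨s.failed, s'.out, t, t', max m m'⟩, ⟨s, s', m, m', hp, he, rfl, rfl, rfl⟩,
    max_le hm hm', ht, ht', hout, hC.failed⟩

theorem isTwoColoring_map {vs : List ℕ} (hvs : vs.Nodup) {W : Finset ℕ} (hW : vs.toFinset = W)
    (c : ℕ → ℕ) (M : Set ℕ) : IsTwoColoring (vs.map fun u => (u, finalColor c M u)) W := by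
  have h : (vs.map fun u => (u, finalColor c M u)).map Prod.fst = vs := by
    simp [List.map_map, Function.comp_def]
  refine ⟨by rwa [h], by rw [h, hW], fun p hp => ?_⟩
  obtain ⟨u, -, rfl⟩ := List.mem_map.1 hp
  simp only [finalColor]
  split_ifs <;> simp

theorem toFinset_vertices {S : List (List ℕ)} {E : Finset (Finset ℕ)} (hS : IsStreamOf S E) :
    (vertices S).toFinset = E.biUnion id := by
  ext u
  rw [List.mem_toFinset, vertices, mem_discover, ← hS.2.2]
  simp

theorem mem_of_isStreamOf {S : List (List ℕ)} {E : Finset (Finset ℕ)} (hS : IsStreamOf S E)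
    {h : List ℕ} (hh : h ∈ S) : h.toFinset ∈ E := by
  rw [← hS.2.2]
  simp only [List.mem_toFinset, List.mem_map]
  exact ⟨h, hh, rfl⟩

theorem isProper_of_disjoint {n : ℕ} {V : Finset ℕ} {S : List (List ℕ)} {E : Finset (Finset ℕ)}
    (hn : 1 ≤ n) (hE : IsUniformHypergraph n V E) (hS : IsStreamOf S E) {ω : ℕ → Bool}
    (hd : Disjoint (frozenSet n S ω) (flippedSet n S ω)) :
    IsProper ((vertices S).map
      (fun u => (u, finalColor (color n S ω) (flippedSet n S ω) u))) E := by
  intro e he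
  have he' := he
  rw [← hS.2.2] at he'
  simp only [List.mem_toFinset, List.mem_map] at he'
  obtain ⟨h, hh, rfl⟩ := he'
  have hne : h ≠ [] := by
    rintro rfl
    have := (hE _ he).2
    simp at this
    omega
  have hv : ∀ u ∈ h, u ∈ vertices S := fun u hu =>
    mem_discover.2 (.inr (List.mem_flatten.2 ⟨h, hh, hu⟩))
  obtain ⟨⟨u, hu, hu0⟩, v, hv', hv1⟩ := exists_finalColor (color_le_one n S ω) hd hne
    (fun k u hu => ⟨h, hh, k, hu⟩) fun u hm hu => ⟨h, hh, hm, hu⟩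
  exact ⟨⟨u, by simpa using hu, List.mem_map.2 ⟨u, hv u hu, by rw [hu0]⟩⟩,
    ⟨v, by simpa using hv', List.mem_map.2 ⟨v, hv v hv', by rw [hv1]⟩⟩⟩

/-- A vertex v of both hyperedges is not before u, by minimality in e, and not after u, by
maximality in f, as it shares the color of u; so v = u. From the remaining comparisons only weak
inequalities of weights are kept, which removes the dependence on names. -/
theorem assignment_mem_of_not_disjoint {n : ℕ} {S : List (List ℕ)} {E : Finset (Finset ℕ)}
    (hS : IsStreamOf S E) {ω : ℕ → Bool}
    (hd : ¬Disjoint (frozenSet n S ω) (flippedSet n S ω)) :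
    assignment (Nat.clog 2 n) (position S) (E.biUnion id) ω ∈
      badAssignments (2 ^ Nat.clog 2 n) (E.biUnion id) E := by
  obtain ⟨u, ⟨f, hf, k, huf, huk, hlast⟩, ⟨e, he, hm, hue, hfirst⟩⟩ := Set.not_disjoint_iff.1 hd
  have he' := mem_of_isStreamOf hS he
  have hf' := mem_of_isStreamOf hS hf
  have hcol : ∀ v, color n S ω v = color n S ω u →
      ω (position S v * (Nat.clog 2 n + 1) + Nat.clog 2 n) =
        ω (position S u * (Nat.clog 2 n + 1) + Nat.clog 2 n) := fun v hv => by
    unfold color at hv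
    revert hv
    cases ω (position S v * (Nat.clog 2 n + 1) + Nat.clog 2 n) <;>
      cases ω (position S u * (Nat.clog 2 n + 1) + Nat.clog 2 n) <;> simp
  refine ⟨e.toFinset, he', f.toFinset, hf',
    ⟨u, Finset.mem_biUnion.2 ⟨_, he', by simpa using hue⟩⟩, ?_, ?_, ?_⟩
  · ext v
    simp only [Finset.mem_inter, List.mem_toFinset, Finset.mem_singleton]
    refine ⟨fun hv => ?_, fun hv => hv ▸ ⟨hue, huf⟩⟩
    have h1 := hfirst v hv.1
    have h2 := hlast v hv.2 ((hm v hv.1 u hue).trans huk)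
    unfold KeyLE at h1 h2
    omega
  · rintro ⟨v, hv'⟩ hv
    have hv : v ∈ e := by simpa using hv
    refine ⟨hcol v (hm v hv u hue), ?_⟩
    have h1 := hfirst v hv
    unfold KeyLE weight at h1
    simp only [assignment, Fin.mk_le_mk]
    omega
  · rintro ⟨v, hv'⟩ hv hvc
    have hv : v ∈ f := by simpa using hv
    have h1 := hlast v hv ((congrArg Bool.toNat hvc).trans huk)
    unfold KeyLE weight at h1
    simp only [assignment, Fin.mk_le_mk]
    omega

theorem exists_position {S : List (List ℕ)} {W : Finset ℕ} (hW : (vertices S).toFinset = W) :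
    ∀ i < W.card, ∃ v ∈ W, position S v = i := by
  intro i hi
  have hlen : i < (vertices S).reverse.length := by
    rwa [← hW, List.toFinset_card_of_nodup (nodup_vertices S), ← List.length_reverse] at hi
  refine ⟨(vertices S).reverse[i], ?_, ?_⟩
  · rw [← hW, List.mem_toFinset, ← List.mem_reverse]
    exact List.getElem_mem hlen
  · exact (List.nodup_reverse.2 (nodup_vertices S)).idxOf_getElem i hlen

end StreamColoring

/-! ### Resource bounds and success probability -/

theorem theorem2 :
    ∃ (A : StreamColoring.StreamAlg) (C : ℕ),
      ∀ (n B : ℕ) (V : Finset ℕ) (E : Finset (Finset ℕ)) (S : List (List ℕ)),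
        100 ≤ n → n ≤ V.card → (∀ u ∈ V, u < 2 ^ B) →
        StreamColoring.IsUniformHypergraph n V E → StreamColoring.IsStreamOf S E →
        (∀ ω : ℕ → Bool, ∃ r : StreamColoring.Result,
          A.Run n B ω S r ∧
          r.space ≤ C * (V.card * B) ∧
          r.updateTime ≤ C * (n * V.card * B) ∧
          r.reportTime ≤ C * (n * V.card * B) ∧
          StreamColoring.IsTwoColoring r.coloring (E.biUnion id) ∧
          ∀ L, r.output = some L → StreamColoring.IsProper L E) ∧
        ((E.card : ℝ) ≤ 1 / 10 * Real.sqrt (n / Real.log n) * 2 ^ n →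
          3 / 4 ≤ StreamColoring.fairBits
            {ω | ∃ (r : StreamColoring.Result) (L : List (ℕ × ℕ)),
              A.Run n B ω S r ∧ r.output = some L ∧
              StreamColoring.IsTwoColoring L (E.biUnion id) ∧ StreamColoring.IsProper L E}) := by
  refine ⟨StreamColoring.alg, 64, fun n B V E S hn hnV hVB hE hS => ?_⟩
  have hVcard : V.card ≤ 2 ^ B := by
    rw [← Finset.card_range (2 ^ B)]
    exact Finset.card_le_card fun u hu => Finset.mem_range.2 (hVB u hu)
  -- From 100 ≤ v ≤ 2^B. It gives 2B + 9 ≤ 4B, so additive constants are absorbed.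
  have hB : 7 ≤ B := by
    by_contra hB
    have : 2 ^ B ≤ 2 ^ 6 := Nat.pow_le_pow_right (by norm_num) (by omega)
    omega
  have hSV : ∀ h ∈ S, h.length = n ∧ ∀ u ∈ h, u ∈ V := by
    intro h hh
    obtain ⟨h1, h2⟩ := hE _ (StreamColoring.mem_of_isStreamOf hS hh)
    rw [List.toFinset_card_of_nodup (hS.1 h hh)] at h2
    exact ⟨h2, fun u hu => h1 (by simpa using hu)⟩
  have hW := StreamColoring.toFinset_vertices hS
  have hlen : (StreamColoring.vertices S).length ≤ V.card := by
    rw [← List.toFinset_card_of_nodup (StreamColoring.nodup_vertices S), hW]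
    exact Finset.card_le_card (Finset.biUnion_subset.2 fun e he => (hE e he).1)
  have hrun := StreamColoring.exists_run hVB (by omega) (hnV.trans hVcard) hSV
  have htwo := fun ω => StreamColoring.isTwoColoring_map (StreamColoring.nodup_vertices S) hW
    (StreamColoring.color n S ω) (StreamColoring.flippedSet n S ω)
  refine ⟨fun ω => ?_, fun hK => ?_⟩
  · obtain ⟨r, hr, hspace, hupd, hrep, hcol, hfail⟩ := hrun ω
    refine ⟨r, hr, hspace.trans ?_, hupd.trans ?_, hrep.trans ?_, hcol ▸ htwo ω, fun L hL => ?_⟩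
    · unfold StreamColoring.spaceBound
      nlinarith
    · have hD : Nat.clog 2 n ≤ V.card :=
        (Nat.clog_le_of_le_pow Nat.lt_two_pow_self.le).trans hnV
      have h1 : n * (7 * Nat.clog 2 n + 54) + 58 ≤ 8 * (n * V.card) := by nlinarith
      calc _ ≤ 8 * (n * V.card) * (4 * B) := Nat.mul_le_mul h1 (by omega)
        _ ≤ 64 * (n * V.card * B) := by nlinarith [Nat.zero_le (n * V.card * B)]
    · calc _ ≤ (16 * V.card) * (4 * B) := Nat.mul_le_mul (by omega) (by omega)
        _ = 64 * (1 * V.card * B) := by ring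
        _ ≤ 64 * (n * V.card * B) := by gcongr; omega
    · unfold StreamColoring.Result.output at hL
      split_ifs at hL with hf
      rw [← Option.some.inj hL, hcol]
      exact StreamColoring.isProper_of_disjoint (by omega) hE hS (hfail.1 (by simpa using hf))
  · set G := {ω | ∃ (r : StreamColoring.Result) (L : List (ℕ × ℕ)),
      StreamColoring.alg.Run n B ω S r ∧ r.output = some L ∧
      StreamColoring.IsTwoColoring L (E.biUnion id) ∧ StreamColoring.IsProper L E}
    set bad := {ω | StreamColoring.assignment (Nat.clog 2 n) (StreamColoring.position S)
      (E.biUnion id) ω ∈ StreamColoring.badAssignments (2 ^ Nat.clog 2 n) (E.biUnion id) E}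
    have hbad : StreamColoring.fairBits bad ≤ 1 / 4 :=
      StreamColoring.fairBits_assignment_le _ _ _ (StreamColoring.exists_position hW) _
        (StreamColoring.ncard_badAssignments_le hn (Nat.le_pow_clog (by norm_num) n) _ E
          (fun e he => ⟨Finset.subset_biUnion_of_mem id he, (hE e he).2⟩) hK)
    -- Success and bad assignments cover everything, so subadditivity bounds the success probability
    -- below without measurability of either event.
    have hcover : (Set.univ : Set (ℕ → Bool)) ⊆ G ∪ bad := by
      intro ω _
      by_cases hd : Disjoint (StreamColoring.frozenSet n S ω) (StreamColoring.flippedSet n S ω)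
      · left
        obtain ⟨r, hr, -, -, -, hcol, hfail⟩ := hrun ω
        refine ⟨r, r.coloring, hr, ?_, hcol ▸ htwo ω,
          hcol ▸ StreamColoring.isProper_of_disjoint (by omega) hE hS hd⟩
        simp [StreamColoring.Result.output, hfail.2 hd]
      · exact .inr (StreamColoring.assignment_mem_of_not_disjoint hS hd)
    have hsum : 1 ≤ StreamColoring.fairBits G + 1 / 4 := by
      calc (1 : ENNReal) = StreamColoring.fairBits Set.univ := MeasureTheory.measure_univ.symm
        _ ≤ StreamColoring.fairBits (G ∪ bad) := MeasureTheory.measure_mono hcover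
        _ ≤ StreamColoring.fairBits G + StreamColoring.fairBits bad :=
            MeasureTheory.measure_union_le _ _
        _ ≤ _ := by gcongr
    have hq : (3 / 4 : ENNReal) + 1 / 4 = 1 := by
      rw [ENNReal.div_add_div_same, show (3 + 1 : ENNReal) = 4 by norm_num]
      exact ENNReal.div_self (by norm_num) (by norm_num)
    exact (ENNReal.add_le_add_iff_right (show (1 / 4 : ENNReal) ≠ ⊤ by finiteness)).1
      (hq.trans_le hsum)
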